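/- **Setting.** A *Bellman–Ford (BF) instance* $G$ is a finite undirected graph with vertex labels $a_G(v)\ge 0$ and edge weights $w_G(e)\ge 0$; we put $w_G(v,v)=0$ and let $N(v)$ denote the set of neighbours of $v$ together with $v$ itself. The Bellman–Ford update $\Gamma$ replaces the labels by $a_{\Gamma(G)}(v)=\min_{u\in N(v)}\bigl(a_G(u)+w_G(u,v)\bigr)$, and $x_v^{(t)}=a_{\Gamma^t(G)}(v)$ is the $t$-step BF distance. *Model.* Let $K,m,d\ge 1$ be integers and $J=2mK$. The bias-free min-aggregation MPNN with $K$ layers has $h^{(0)}_v=a_G(v)$ and, for $1\le t\le K$, $$h_v^{(t)}=\mathrm{UPD}_t\Bigl(\min_{u\in N(v)}\mathrm{AGG}_t\bigl(h_u^{(t-1)},w_G(v,u)\bigr)\Bigr),$$ where $\mathrm{AGG}_t$ and $\mathrm{UPD}_t$ are $m$-layer feedforward networks without biases, with ReLU applied componentwise after every layer. The $J$ layers are numbered in order of application: $\mathrm{AGG}_1,\mathrm{UPD}_1,\mathrm{AGG}_2,\dots,\mathrm{UPD}_K$. The input dimension, the output dimension and the output dimension of every $\mathrm{AGG}_t$ are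 $1$; all other feature dimensions equal $d$. Let $W^j$ be the weight matrix of layer $j$ acting on vertex features. The first layer of $\mathrm{AGG}_k$ has number $j_k=2m(k-1)+1$ and has an additional weight column $C^k$ acting on the edge weight; put $j_0=0$. The parameter $\theta$ consists of all $W^j$ ($1\le j\le J$) and $C^k$ ($1\le k\le K$). *Loss.* For a finite set $X$ of pairs $(G,v)$ with $G$ a BF instance and $v\in V(G)$, $N=|X|$ and $\eta>0$, let $$\mathcal L(\theta)=\frac1N\sum_{(G,v)\in X}\bigl|h_v^{(K)}-x_v^{(K)}\bigr|+\eta\Bigl(\sum_{k=0}^K\sum_{j=j_k+1}^{J}\|W^j\|_1+\sum_{k=1}^K\|C^k\|_1\Bigr),$$ with $\|\cdot\|_1$ the entrywise $\ell^1$ norm. *Path training set.* For $w\in\mathbb R_{\ge0}^{K+1}$, with coordinates indexed by $0,\dots,K$, and $\beta\ge 0$ let $P_\beta(w)$ be the path $v_0,\dots,v_K$ with label $w_0$ at $v_0$, label $\beta$ at $v_1,\dots,v_K$, and weight $w_i$ on the edge $\{v_{i-1},v_i\}$. For $x\ge0$ let $T_{S_{x,K}}$ be the set of the $K+1$ pairs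 $(P_\beta(x e_k),v_K)$, $k=0,\dots,K$, where $e_0,\dots,e_K$ is the canonical basis of $\mathbb R^{K+1}$ and $\beta\ge 2(N+x+1)$. **Theorem.** Let $K,m\ge 1$ be integers and $\eta>0$. There is a constant $C>0$, depending only on $K$, $m$ and $\eta$, such that the following holds for every $d\ge1$. Let $X$ be a finite training set with $|X|=N$, let $x\ge 0$ and $\beta\ge 2(N+x+1)$, and assume $T_{S_{x,K}}\subseteq X$ and $x\ge 4mKN\eta$. If $$0\le\varepsilon<\min\bigl\{2\eta mK(K+3),\tfrac12\bigr\}$$ and the parameter $\theta$ satisfies $\mathcal L(\theta)\le\mathcal L(\theta')+\varepsilon$ for all parameters $\theta'$, then for every BF instance $G$ and every $v\in V(G)$, $$\bigl|h_v^{(K)}-x_v^{(K)}\bigr|\le\varepsilon\,C\,x_v^{(K)}.$$ -/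

import Mathlib

open scoped NNReal

/-- A Bellman-Ford instance: a finite undirected graph with non-negative vertex labels and
non-negative edge weights. The weight function is extended by `0` to pairs that are not edges;
in particular `weight v v = 0`. -/
structure BFInstance where
  V : Type
  [fintypeV : Fintype V]
  graph : SimpleGraph V
  label : V → ℝ≥0
  weight : V → V → ℝ≥0
  weight_symm : ∀ u v, weight u v = weight v u
  weight_eq_zero : ∀ u v, ¬ graph.Adj u v → weight u v = 0

attribute [instance] BFInstance.fintypeV

namespace BFInstance

open Classical in
/-- The neighbourhood `N(v) ∪ {v}`. -/
noncomputable def nbhd (G : BFInstance) (v : G.V) : Finset G.V :=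
  Finset.univ.filter fun u => u = v ∨ G.graph.Adj v u

theorem nbhd_nonempty (G : BFInstance) (v : G.V) : (G.nbhd v).Nonempty :=
  ⟨v, by simp [nbhd]⟩

/-- The Bellman-Ford update, acting on the vertex labels (vertices, edges and edge weights are
left unchanged). -/
noncomputable def update (G : BFInstance) (a : G.V → ℝ≥0) : G.V → ℝ≥0 := fun v =>
  (G.nbhd v).inf' (G.nbhd_nonempty v) fun u => a u + G.weight u v

/-- The `t`-step Bellman-Ford distance of `v`. -/
noncomputable def dist (G : BFInstance) (t : ℕ) (v : G.V) : ℝ≥0 :=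
  (G.update^[t] G.label) v

/-- The path `v₀, …, v_K` with label `w₀` at `v₀`, label `β` at all other vertices, and weight
`wᵢ` on the edge `{vᵢ₋₁, vᵢ}`. -/
noncomputable def path (K : ℕ) (β : ℝ≥0) (w : Fin (K + 1) → ℝ≥0) : BFInstance where
  V := Fin (K + 1)
  graph := SimpleGraph.pathGraph (K + 1)
  label i := if i = 0 then w 0 else β
  weight i j :=
    open Classical in if (SimpleGraph.pathGraph (K + 1)).Adj i j then w (max i j) else 0
  weight_symm i j := by rw [max_comm, SimpleGraph.adj_comm]
  weight_eq_zero i j h := by simp [h]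

end BFInstance

/-- The input space of a vertex-level task: pairs of a BF instance and one of its vertices. -/
abbrev BFVertex : Type 1 := Σ G : BFInstance, G.V

/-- The Bellman-Ford path training set: the end vertices of the paths with weight vectors
`x e₀, …, x e_K`. -/
noncomputable def pathTrainingSet (K : ℕ) (x β : ℝ≥0) : Set BFVertex :=
  Set.range fun k : Fin (K + 1) =>
    (⟨BFInstance.path K β (Pi.single k x), Fin.last K⟩ : BFVertex)

/-- The feature dimension after the `j`-th of the `2mK` global layers. The layers
`2mt + 1, …, 2mt + m` form the aggregation network of the message passing step `t + 1`, and the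
layers `2mt + m + 1, …, 2mt + 2m` form its update network (`t = 0, …, K - 1`). Input, output and
aggregation dimensions are `1`, all others are `d`. -/
def layerDim (K m d j : ℕ) : ℕ :=
  if j = 0 ∨ j = 2 * m * K ∨ ∃ t < K, j = 2 * m * t + m then 1 else d

theorem layerDim_last (K m d : ℕ) : layerDim K m d (2 * m * K) = 1 := by
  simp [layerDim]

/-- Parameters of the bias-free MPNN. `W j` is the weight matrix of the global layer `j + 1` that
acts on vertex features, and `C t` is the column of the first layer of the `(t + 1)`-st
aggregation network that acts on the edge weight. -/
structure MPNNParams (K m d : ℕ) where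
  W : (j : Fin (2 * m * K)) → Matrix (Fin (layerDim K m d (j + 1))) (Fin (layerDim K m d j)) ℝ
  C : (t : Fin K) → Fin (layerDim K m d (2 * m * t + 1)) → ℝ

namespace MPNNParams

variable {K m d : ℕ}

/-- `W`, extended by zero to all `j : ℕ`. -/
def weight (θ : MPNNParams K m d) (j : ℕ) :
    Matrix (Fin (layerDim K m d (j + 1))) (Fin (layerDim K m d j)) ℝ :=
  if h : j < 2 * m * K then θ.W ⟨j, h⟩ else 0

/-- `C`, extended by zero to all `t : ℕ`. -/
def edgeWeight (θ : MPNNParams K m d) (t : ℕ) : Fin (layerDim K m d (2 * m * t + 1)) → ℝ :=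
  if h : t < K then θ.C ⟨t, h⟩ else 0

/-- The ReLU network made of the `l` global layers `p + 1, …, p + l`. -/
noncomputable def fnn (θ : MPNNParams K m d) (p : ℕ) (y : Fin (layerDim K m d p) → ℝ) :
    (l : ℕ) → Fin (layerDim K m d (p + l)) → ℝ
  | 0 => y
  | l + 1 => fun i => max 0 ((θ.weight (p + l)).mulVec (fnn θ p y l) i)

/-- The first `l` layers of the aggregation network of step `t + 1`, applied to a vertex feature
`y` and an edge weight `e`. The edge weight enters in the first layer. -/
noncomputable def agg (θ : MPNNParams K m d) (t : ℕ)
    (y : Fin (layerDim K m d (2 * m * t)) → ℝ) (e : ℝ) :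
    (l : ℕ) → Fin (layerDim K m d (2 * m * t + l)) → ℝ
  | 0 => y
  | 1 => fun i => max 0 ((θ.weight (2 * m * t)).mulVec y i + θ.edgeWeight t i * e)
  | l + 2 => fun i => max 0 ((θ.weight (2 * m * t + (l + 1))).mulVec (agg θ t y e (l + 1)) i)

/-- The vertex features after `t` message passing steps with (entrywise) minimum aggregation. -/
noncomputable def feature (θ : MPNNParams K m d) (G : BFInstance) :
    (t : ℕ) → G.V → Fin (layerDim K m d (2 * m * t)) → ℝ
  | 0 => fun v _ => G.label v
  | t + 1 => fun v i =>
      θ.fnn (2 * m * t + m)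
        (fun r => (G.nbhd v).inf' (G.nbhd_nonempty v) fun u =>
          θ.agg t (feature θ G t u) (G.weight v u) m r)
        m (Fin.cast (congrArg (layerDim K m d) (by ring)) i)

/-- The scalar output of the MPNN after `K` steps. -/
noncomputable def output (θ : MPNNParams K m d) (G : BFInstance) (v : G.V) : ℝ :=
  θ.feature G K v ⟨0, by rw [layerDim_last]; exact Nat.one_pos⟩

/-- The entrywise `ℓ¹` norm of the weight matrix of the global layer `j`, `1 ≤ j ≤ 2mK`. -/
noncomputable def normW (θ : MPNNParams K m d) (j : ℕ) : ℝ :=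
  ∑ r, ∑ s, |θ.weight (j - 1) r s|

/-- The index of the `k`-th edge-inserting layer, i.e. of the first layer of the `k`-th
aggregation network, for `k ≥ 1`; by convention it is `0` for `k = 0`. -/
def edgeLayer (m k : ℕ) : ℕ := if k = 0 then 0 else 2 * m * (k - 1) + 1

noncomputable def regLoss (θ : MPNNParams K m d) : ℝ :=
  (∑ k ∈ Finset.range (K + 1), ∑ j ∈ Finset.Ioc (edgeLayer m k) (2 * m * K), θ.normW j) +
    ∑ t : Fin K, ∑ r, |θ.C t r|

noncomputable def empLoss (X : Finset BFVertex) (θ : MPNNParams K m d) : ℝ :=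
  (1 / (X.card : ℝ)) * ∑ p ∈ X, |θ.output p.1 p.2 - (p.1.dist K p.2 : ℝ)|

noncomputable def loss (η : ℝ) (X : Finset BFVertex) (θ : MPNNParams K m d) : ℝ :=
  empLoss X θ + η * regLoss θ

end MPNNParams

/-! Let J = 2mK. On the training path with weight vector x e_k the output is at most x P_k. Here P_0
is the product of the ℓ¹ norms of all matrices, and for k ≥ 1, P_k is the norm of C^k times the
norms of all matrices in later layers. The regulariser splits as a sum of S_k, where S_k is the sum
of the n_k factors of P_k. By AM-GM, an output of at least ρx with ρ ≤ 1 forces S_k ≥ n_k ρ. Since x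
≥ 2JNη, pushing the output below x costs more empirical loss than the smaller norms save. So every k
has a non-negative excess over η n_k, and exact Bellman–Ford parameters attain η n_k for all k at
once. Near-minimality then bounds each excess by ε (`excess_bound`): each path output is at least (1
- ε/(ηJ))x and P_k ≤ exp(ε/η).

The bound on the P_k gives the upper estimate on every graph: along an optimal walk features grow at
most by the norms, and the minimum only lowers them (`EdgeNet.tail_mul_feat_le`).

For the lower estimate, the path outputs nearly attain the products of norms. This forces every
matrix to concentrate on one entry, the entries to link into one chain of units from input to
output, and each C^k to concentrate on the same chain (`EdgeNet.exists_dominant_of_pathOut`). The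
chain unit is then the largest coordinate of every feature, also after the entrywise minimum, so on
it the network runs Bellman–Ford up to a factor near 1 (`EdgeNet.Dominant.feat_lower`). -/

/-- A bias-free ReLU network whose layers all have features indexed by `I`. The layer `j` has the
weight matrix `W j` and the column `E j` acting on an edge weight. -/
structure EdgeNet (I : Type) where
  W : ℕ → I → I → ℝ
  E : ℕ → I → ℝ

/-! ### Uniform-width networks and growth bounds by weight norms -/

namespace EdgeNet

variable {I : Type} [Fintype I]

noncomputable def step (N : EdgeNet I) (j : ℕ) (y : I → ℝ) (e : ℝ) : I → ℝ :=
  fun i => max 0 (∑ s, N.W j i s * y s + N.E j i * e)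

/-- The layers `p, …, p + l - 1`. -/
noncomputable def run (N : EdgeNet I) (p : ℕ) (y : I → ℝ) (e : ℝ) : ℕ → I → ℝ
  | 0 => y
  | l + 1 => N.step (p + l) (N.run p y e l) e

/-- The entrywise minimum over the neighbourhood of the messages of step `t + 1`. -/
noncomputable def aggMin (N : EdgeNet I) (m : ℕ) (G : BFInstance) (t : ℕ) (f : G.V → I → ℝ)
    (v : G.V) : I → ℝ :=
  fun r => (G.nbhd v).inf' (G.nbhd_nonempty v) fun u =>
    N.run (2 * m * t) (f u) (G.weight v u) m r

open Classical in
noncomputable def feat (N : EdgeNet I) (m : ℕ) (o : I) (G : BFInstance) : ℕ → G.V → I → ℝ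
  | 0 => fun v i => if i = o then (G.label v : ℝ) else 0
  | t + 1 => fun v => N.run (2 * m * t + m) (N.aggMin m G t (N.feat m o G t) v) 0 m

noncomputable def normW (N : EdgeNet I) (j : ℕ) : ℝ := ∑ r, ∑ s, |N.W j r s|

noncomputable def normE (N : EdgeNet I) (j : ℕ) : ℝ := ∑ r, |N.E j r|

/-- The product of the norms of the layers `j, …, J - 1`. -/
noncomputable def tail (N : EdgeNet I) (J j : ℕ) : ℝ := ∏ q ∈ Finset.Ico j J, N.normW q

variable (N : EdgeNet I)

theorem normW_nonneg (j : ℕ) : 0 ≤ N.normW j :=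
  Finset.sum_nonneg fun _ _ => Finset.sum_nonneg fun _ _ => abs_nonneg _

theorem normE_nonneg (j : ℕ) : 0 ≤ N.normE j :=
  Finset.sum_nonneg fun _ _ => abs_nonneg _

theorem tail_nonneg (J j : ℕ) : 0 ≤ N.tail J j :=
  Finset.prod_nonneg fun _ _ => N.normW_nonneg _

theorem tail_self (J : ℕ) : N.tail J J = 1 := by simp [tail]

theorem tail_eq_mul {J j : ℕ} (h : j < J) : N.tail J j = N.normW j * N.tail J (j + 1) :=
  Finset.prod_eq_prod_Ico_succ_bot h _

theorem step_nonneg (j : ℕ) (y : I → ℝ) (e : ℝ) (i : I) : 0 ≤ N.step j y e i := le_max_left _ _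

theorem run_nonneg (p : ℕ) {y : I → ℝ} (hy : ∀ i, 0 ≤ y i) (e : ℝ) (l : ℕ) (i : I) :
    0 ≤ N.run p y e l i := by
  cases l with
  | zero => exact hy i
  | succ l => exact N.step_nonneg _ _ _ _

theorem aggMin_nonneg (m : ℕ) (G : BFInstance) (t : ℕ) {f : G.V → I → ℝ}
    (hf : ∀ v i, 0 ≤ f v i) (v : G.V) (i : I) : 0 ≤ N.aggMin m G t f v i :=
  Finset.le_inf' _ _ fun u _ => N.run_nonneg _ (hf u) _ _ _

theorem aggMin_le (m : ℕ) (G : BFInstance) (t : ℕ) (f : G.V → I → ℝ) {u v : G.V}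
    (hu : u ∈ G.nbhd v) (i : I) :
    N.aggMin m G t f v i ≤ N.run (2 * m * t) (f u) (G.weight v u) m i :=
  Finset.inf'_le (fun u => N.run (2 * m * t) (f u) (G.weight v u) m i) hu

theorem feat_nonneg (m : ℕ) (o : I) (G : BFInstance) (t : ℕ) (v : G.V) (i : I) :
    0 ≤ N.feat m o G t v i := by
  induction t generalizing v i with
  | zero => simp only [feat]; split_ifs <;> simp
  | succ t ih => exact N.run_nonneg _ (N.aggMin_nonneg m G t ih v) _ _ _

theorem sum_step_le (j : ℕ) {y : I → ℝ} {M e : ℝ} (hy : ∀ s, 0 ≤ y s) (hM : ∀ s, y s ≤ M)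
    (he : 0 ≤ e) : ∑ i, N.step j y e i ≤ N.normW j * M + N.normE j * e := by
  rw [normW, normE, Finset.sum_mul, Finset.sum_mul, ← Finset.sum_add_distrib]
  refine Finset.sum_le_sum fun i _ => max_le ?_ ?_
  · have : ∀ s, 0 ≤ |N.W j i s| * M := fun s => mul_nonneg (abs_nonneg _) ((hy s).trans (hM s))
    rw [Finset.sum_mul]
    exact add_nonneg (Finset.sum_nonneg fun s _ => this s) (mul_nonneg (abs_nonneg _) he)
  · rw [Finset.sum_mul]
    refine add_le_add (Finset.sum_le_sum fun s _ => ?_)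
      (mul_le_mul_of_nonneg_right (le_abs_self _) he)
    exact (mul_le_mul_of_nonneg_right (le_abs_self _) (hy s)).trans
      (mul_le_mul_of_nonneg_left (hM s) (abs_nonneg _))

theorem step_le (j : ℕ) {y : I → ℝ} {M e : ℝ} (hy : ∀ s, 0 ≤ y s) (hM : ∀ s, y s ≤ M)
    (he : 0 ≤ e) (i : I) : N.step j y e i ≤ N.normW j * M + N.normE j * e :=
  (Finset.single_le_sum (fun i _ => N.step_nonneg j y e i) (Finset.mem_univ i)).trans
    (N.sum_step_le j hy hM he)

theorem normE_eq_zero {j : ℕ} (h : N.E j = 0) : N.normE j = 0 := by simp [normE, h]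

/-- The norms of the remaining layers bound the growth of the features. -/
theorem tail_mul_run_le {J p l : ℕ} (hl : 1 ≤ l) (hJ : p + l ≤ J)
    (hE : ∀ q, 0 < q → q < l → N.E (p + q) = 0) {y : I → ℝ} {M e : ℝ} (hy : ∀ s, 0 ≤ y s)
    (hM : ∀ s, y s ≤ M) (he : 0 ≤ e) (i : I) :
    N.tail J (p + l) * N.run p y e l i ≤
      N.tail J p * M + N.tail J (p + 1) * N.normE p * e := by
  induction l, hl using Nat.le_induction generalizing i with
  | base =>
    rw [N.tail_eq_mul (j := p) (by omega)]
    have := mul_le_mul_of_nonneg_left (N.step_le p hy hM he i) (N.tail_nonneg J (p + 1))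
    simp only [run, add_zero]
    linarith
  | succ l hl ih =>
    have : Nonempty I := ⟨i⟩
    obtain ⟨s₀, hs₀⟩ := Finite.exists_max (N.run p y e l)
    have h1 := N.step_le (p + l) (N.run_nonneg p hy e l) hs₀ he i
    rw [N.normE_eq_zero (hE l (by omega) (by omega)), zero_mul, add_zero] at h1
    have h2 := mul_le_mul_of_nonneg_left h1 (N.tail_nonneg J (p + l + 1))
    have h3 := ih (by omega) (fun q h h' => hE q h (by omega)) s₀
    rw [N.tail_eq_mul (j := p + l) (by omega)] at h3
    simp only [run, ← add_assoc]
    linarith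

end EdgeNet

namespace BFInstance

theorem dist_zero (G : BFInstance) (v : G.V) : G.dist 0 v = G.label v := rfl

theorem dist_succ (G : BFInstance) (t : ℕ) (v : G.V) :
    G.dist (t + 1) v =
      (G.nbhd v).inf' (G.nbhd_nonempty v) fun u => G.dist t u + G.weight u v := by
  rw [dist, Function.iterate_succ_apply']; rfl

theorem dist_succ_le (G : BFInstance) (t : ℕ) {u v : G.V} (hu : u ∈ G.nbhd v) :
    (G.dist (t + 1) v : ℝ) ≤ G.dist t u + G.weight v u := by
  rw [dist_succ, weight_symm G v u]
  exact_mod_cast Finset.inf'_le (fun u => G.dist t u + G.weight u v) hu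

theorem exists_dist_succ_eq (G : BFInstance) (t : ℕ) (v : G.V) :
    ∃ u ∈ G.nbhd v, (G.dist (t + 1) v : ℝ) = G.dist t u + G.weight v u := by
  obtain ⟨u, hu, h⟩ := Finset.exists_mem_eq_inf' (G.nbhd_nonempty v)
    fun u => G.dist t u + G.weight u v
  refine ⟨u, hu, ?_⟩
  rw [dist_succ, h, weight_symm G v u]
  push_cast; rfl

end BFInstance

/-! ### Comparing features with Bellman–Ford distances, from above and below -/

namespace EdgeNet

variable {I : Type} [Fintype I] (N : EdgeNet I)

theorem layer_index_bound {m K t : ℕ} (h : t < K) : 2 * m * t + m + m ≤ 2 * m * K := by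
  have := Nat.mul_le_mul_left (2 * m) (Nat.succ_le_of_lt h)
  rw [Nat.mul_succ] at this
  omega

/-- Multiplying by the norms of the layers still to come gives a quantity that needs no rescaling
between layers. The minimum is bounded by the message of a neighbour `u` realising the Bellman–Ford
distance, and the new edge weight enters with a coefficient that `A` bounds. At `t = K` the factor
is 1. -/
theorem tail_mul_feat_le {m K : ℕ} (hm : 1 ≤ m) (o : I)
    (hE : ∀ t q, 0 < q → q < 2 * m → N.E (2 * m * t + q) = 0) {A : ℝ}
    (hA₀ : N.tail (2 * m * K) 0 ≤ A)
    (hA : ∀ t < K, N.tail (2 * m * K) (2 * m * t + 1) * N.normE (2 * m * t) ≤ A)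
    (G : BFInstance) {t : ℕ} (ht : t ≤ K) (v : G.V) (i : I) :
    N.tail (2 * m * K) (2 * m * t) * N.feat m o G t v i ≤ A * G.dist t v := by
  have hA' : 0 ≤ A := (N.tail_nonneg _ _).trans hA₀
  induction t generalizing v i with
  | zero =>
    simp only [feat, mul_zero, BFInstance.dist_zero]
    split_ifs
    · exact mul_le_mul_of_nonneg_right hA₀ (NNReal.coe_nonneg _)
    · rw [mul_zero]; positivity
  | succ t ih =>
    obtain ⟨u, hu, hd⟩ := G.exists_dist_succ_eq t v
    have hJ := layer_index_bound (m := m) (Nat.lt_of_succ_le ht)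
    have : Nonempty I := ⟨i⟩
    obtain ⟨s₁, hs₁⟩ := Finite.exists_max (N.aggMin m G t (N.feat m o G t) v)
    obtain ⟨s₀, hs₀⟩ := Finite.exists_max (N.feat m o G t u)
    have h1 := N.tail_mul_run_le (J := 2 * m * K) hm hJ
      (fun q h h' => by rw [add_assoc]; exact hE t _ (by omega) (by omega))
      (N.aggMin_nonneg m G t (N.feat_nonneg m o G t) v) hs₁ le_rfl i
    have h2 := N.tail_mul_run_le (J := 2 * m * K) (p := 2 * m * t) hm (by omega)
      (fun q h h' => hE t q h (by omega))
      (N.feat_nonneg m o G t u) hs₀ (NNReal.coe_nonneg (G.weight v u)) s₁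
    have h3 := mul_le_mul_of_nonneg_left (N.aggMin_le m G t (N.feat m o G t) hu s₁)
      (N.tail_nonneg (2 * m * K) (2 * m * t + m))
    have h4 := ih (by omega) u s₀
    have h5 := mul_le_mul_of_nonneg_right (hA t (by omega)) (NNReal.coe_nonneg (G.weight v u))
    have h6 : 2 * m * (t + 1) = 2 * m * t + m + m := by ring
    rw [hd, h6]
    simp only [feat]
    linarith

/-- A matrix entry and an entry of the edge column that carry most of the norms dominate the
layer. -/
theorem step_lower {j : ℕ} {a b : I} {γ e : ℝ} {y : I → ℝ} (hγ : 3 * γ ≤ 1)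
    (hW : (1 - γ) * N.normW j ≤ N.W j a b) (hE : (1 - γ) * N.normE j ≤ N.E j a)
    (hy : ∀ s, 0 ≤ y s) (hb : ∀ s, y s ≤ y b) (he : 0 ≤ e) :
    (1 - 2 * γ) * (N.normW j * y b + N.normE j * e) ≤ N.step j y e a ∧
      ∀ i, N.step j y e i ≤ N.step j y e a := by
  have hrow : ∑ s, |N.W j a s| ≤ N.normW j :=
    Finset.single_le_sum (f := fun r => ∑ s, |N.W j r s|)
      (fun r _ => Finset.sum_nonneg fun _ _ => abs_nonneg _) (Finset.mem_univ a)
  have hrow' : N.W j a b ≤ ∑ s, |N.W j a s| := (le_abs_self _).trans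
    (Finset.single_le_sum (f := fun s => |N.W j a s|) (fun s _ => abs_nonneg _)
      (Finset.mem_univ b))
  -- Every summand on the right is non-negative because `y s ≤ y b`, and for `s = b` with a
  -- non-negative entry it is the left side. So the rest of row `a` can cancel at most its own
  -- absolute sum times `y b`.
  have h1 : 2 * (N.W j a b * y b) ≤ ∑ s, (N.W j a s * y s + |N.W j a s| * y b) := by
    rcases le_or_gt 0 (N.W j a b) with h0 | h0
    · refine le_trans ?_ (Finset.single_le_sum
        (f := fun s => N.W j a s * y s + |N.W j a s| * y b) (fun s _ => ?_) (Finset.mem_univ b))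
      · rw [abs_of_nonneg h0]; linarith
      · have := mul_le_mul_of_nonneg_left (hb s) (abs_nonneg (N.W j a s))
        have := mul_le_mul_of_nonneg_right (neg_abs_le (N.W j a s)) (hy s)
        linarith
    · refine le_trans (by nlinarith [hy b]) (Finset.sum_nonneg fun s _ => ?_)
      have := mul_le_mul_of_nonneg_left (hb s) (abs_nonneg (N.W j a s))
      have := mul_le_mul_of_nonneg_right (neg_abs_le (N.W j a s)) (hy s)
      linarith
  rw [Finset.sum_add_distrib, ← Finset.sum_mul] at h1
  have hlow : (1 - 2 * γ) * (N.normW j * y b + N.normE j * e) ≤ N.step j y e a := by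
    refine le_trans ?_ (le_max_right _ _)
    have e1 := mul_le_mul_of_nonneg_right hW (hy b)
    have e2 := mul_le_mul_of_nonneg_right hrow (hy b)
    have e3 := mul_le_mul_of_nonneg_right hE he
    have e4 : 0 ≤ γ * (N.normE j * e) := by
      have : N.E j a ≤ N.normE j := (le_abs_self _).trans
        (Finset.single_le_sum (f := fun s => |N.E j s|) (fun s _ => abs_nonneg _)
          (Finset.mem_univ a))
      nlinarith
    linarith
  refine ⟨hlow, fun i => ?_⟩
  by_cases hi : i = a
  · rw [hi]
  · refine le_trans ?_ hlow
    -- Row `a` already holds the share `1 - γ` of both norms, so any other row holds at most `γ`,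
    -- and `γ ≤ 1 - 2γ`.
    have hpair : ∀ f : I → ℝ, (∀ r, 0 ≤ f r) → f i + f a ≤ ∑ r, f r := fun f hf => by
      classical
      rw [← Finset.sum_pair hi]
      exact Finset.sum_le_sum_of_subset_of_nonneg (Finset.subset_univ _) fun r _ _ => hf r
    have p1 := hpair (fun r => ∑ s, |N.W j r s|)
      fun r => Finset.sum_nonneg fun _ _ => abs_nonneg _
    have p2 := hpair (fun r => |N.E j r|) fun r => abs_nonneg _
    change _ ≤ N.normW j at p1
    change _ ≤ N.normE j at p2
    have q1 : ∑ s, |N.W j i s| ≤ γ * N.normW j := by linarith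
    have q2 : |N.E j i| ≤ γ * N.normE j := by linarith [le_abs_self (N.E j a)]
    have r1 := mul_le_mul_of_nonneg_right q1 (hy b)
    have r2 := mul_le_mul_of_nonneg_right q2 he
    have r3 := mul_nonneg (N.normW_nonneg j) (hy b)
    have r4 := mul_nonneg (N.normE_nonneg j) he
    have r5 : γ * (N.normW j * y b + N.normE j * e) ≤
        (1 - 2 * γ) * (N.normW j * y b + N.normE j * e) :=
      mul_le_mul_of_nonneg_right (by linarith) (by linarith)
    refine max_le (by nlinarith) ?_
    have s1 : ∑ s, N.W j i s * y s ≤ (∑ s, |N.W j i s|) * y b := by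
      rw [Finset.sum_mul]
      refine Finset.sum_le_sum fun s _ => ?_
      exact (mul_le_mul_of_nonneg_right (le_abs_self _) (hy s)).trans
        (mul_le_mul_of_nonneg_left (hb s) (abs_nonneg _))
    have s2 := mul_le_mul_of_nonneg_right (le_abs_self (N.E j i)) he
    linarith

/-- The units `i j` carry most of the norm of all layers before `J`. -/
structure Dominant (N : EdgeNet I) (J : ℕ) (γ : ℝ) (i : ℕ → I) : Prop where
  W : ∀ j < J, (1 - γ) * N.normW j ≤ N.W j (i (j + 1)) (i j)
  E : ∀ j < J, (1 - γ) * N.normE j ≤ N.E j (i (j + 1))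

theorem Dominant.run_lower {N : EdgeNet I} {J : ℕ} {γ : ℝ} {i : ℕ → I} (hN : N.Dominant J γ i)
    (hγ : 3 * γ ≤ 1) {p l : ℕ} (hl : 1 ≤ l) (hJ : p + l ≤ J)
    {y : I → ℝ} {e : ℝ} (hy : ∀ s, 0 ≤ y s) (hb : ∀ s, y s ≤ y (i p)) (he : 0 ≤ e) :
    (1 - 2 * γ) ^ l * (N.tail J p * y (i p) + N.tail J (p + 1) * N.normE p * e) ≤
      N.tail J (p + l) * N.run p y e l (i (p + l)) ∧
    ∀ s, N.run p y e l s ≤ N.run p y e l (i (p + l)) := by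
  induction l, hl using Nat.le_induction with
  | base =>
    obtain ⟨h1, h2⟩ := N.step_lower hγ (hN.W p (by omega)) (hN.E p (by omega)) hy hb he
    refine ⟨?_, h2⟩
    rw [N.tail_eq_mul (j := p) (by omega)]
    have := mul_le_mul_of_nonneg_left h1 (N.tail_nonneg J (p + 1))
    simp only [run, add_zero, pow_one]
    linarith
  | succ l hl ih =>
    obtain ⟨h1, h2⟩ := ih (by omega)
    obtain ⟨h3, h4⟩ := N.step_lower hγ (hN.W (p + l) (by omega)) (hN.E (p + l) (by omega))
      (N.run_nonneg p hy e l) h2 he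
    refine ⟨?_, h4⟩
    rw [N.tail_eq_mul (j := p + l) (by omega)] at h1
    have h5 := mul_le_mul_of_nonneg_left h3 (N.tail_nonneg J (p + l + 1))
    have h6 := mul_le_mul_of_nonneg_left h1 (show 0 ≤ 1 - 2 * γ by linarith)
    have h7 := mul_nonneg (show 0 ≤ 1 - 2 * γ by linarith) (mul_nonneg
      (N.tail_nonneg J (p + l + 1)) (mul_nonneg (N.normE_nonneg (p + l)) he))
    simp only [run, ← add_assoc, pow_succ]
    linarith

/-- The units `i j` do not depend on the graph, so at each step all messages have their maximum at
the same coordinate. On that coordinate the minimum is an honest Bellman–Ford minimum, and each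
layer loses at most a factor `1 - 2γ`. -/
theorem Dominant.feat_lower {N : EdgeNet I} {m K : ℕ} {γ : ℝ} {i : ℕ → I} {o : I}
    (hN : N.Dominant (2 * m * K) γ i) (hm : 1 ≤ m) (hγ₀ : 0 ≤ γ) (hγ : 3 * γ ≤ 1)
    (hi : i 0 = o) {A : ℝ} (hA₀ : A ≤ N.tail (2 * m * K) 0)
    (hA : ∀ t < K, A ≤ N.tail (2 * m * K) (2 * m * t + 1) * N.normE (2 * m * t)) (hA' : 0 ≤ A)
    (G : BFInstance) {t : ℕ} (ht : t ≤ K) (v : G.V) :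
    (1 - 2 * γ) ^ (2 * m * t) * A * G.dist t v ≤
      N.tail (2 * m * K) (2 * m * t) * N.feat m o G t v (i (2 * m * t)) ∧
    ∀ s, N.feat m o G t v s ≤ N.feat m o G t v (i (2 * m * t)) := by
  have hg : 0 ≤ 1 - 2 * γ := by linarith
  induction t generalizing v with
  | zero =>
    simp only [feat, mul_zero, BFInstance.dist_zero, hi, if_true, pow_zero, one_mul]
    refine ⟨mul_le_mul_of_nonneg_right hA₀ (NNReal.coe_nonneg _), fun s => ?_⟩
    split_ifs <;> simp
  | succ t ih =>
    have hJ := layer_index_bound (m := m) (Nat.lt_of_succ_le ht)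
    have hrun := fun u => hN.run_lower hγ (p := 2 * m * t) hm (by omega)
      (N.feat_nonneg m o G t u) (ih (by omega) u).2 (NNReal.coe_nonneg (G.weight v u))
    have hb : ∀ s, N.aggMin m G t (N.feat m o G t) v s ≤
        N.aggMin m G t (N.feat m o G t) v (i (2 * m * t + m)) := fun s =>
      Finset.le_inf' _ _ fun u hu => (N.aggMin_le m G t _ hu s).trans ((hrun u).2 s)
    obtain ⟨h1, h2⟩ := hN.run_lower hγ (p := 2 * m * t + m) hm hJ
      (N.aggMin_nonneg m G t (N.feat_nonneg m o G t) v) hb (le_refl 0)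
    have h6 : 2 * m * (t + 1) = 2 * m * t + m + m := by ring
    rw [h6]
    refine ⟨?_, h2⟩
    simp only [feat]
    refine le_trans ?_ h1
    obtain ⟨u, hu, hmin⟩ := Finset.exists_mem_eq_inf' (G.nbhd_nonempty v) fun u =>
      N.run (2 * m * t) (N.feat m o G t u) (G.weight v u) m (i (2 * m * t + m))
    have h7 := (hrun u).1
    have h8 : N.aggMin m G t (N.feat m o G t) v (i (2 * m * t + m)) = _ := hmin
    have h9 := (ih (by omega) u).1
    have h10 := mul_le_mul_of_nonneg_left (G.dist_succ_le t hu)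
      (mul_nonneg (pow_nonneg hg (2 * m * t)) hA')
    have h11 : (1 - 2 * γ) ^ (2 * m * t) * A ≤
        N.tail (2 * m * K) (2 * m * t + 1) * N.normE (2 * m * t) :=
      (mul_le_of_le_one_left hA' (pow_le_one₀ hg (by linarith))).trans (hA t (by omega))
    have h12 := mul_le_mul_of_nonneg_right h11 (NNReal.coe_nonneg (G.weight v u))
    rw [h8, mul_zero, add_zero]
    calc (1 - 2 * γ) ^ (2 * m * t + m + m) * A * (G.dist (t + 1) v : ℝ)
        = (1 - 2 * γ) ^ m * ((1 - 2 * γ) ^ m *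
            ((1 - 2 * γ) ^ (2 * m * t) * A * (G.dist (t + 1) v : ℝ))) := by
          rw [pow_add, pow_add]; ring
      _ ≤ _ := mul_le_mul_of_nonneg_left ((mul_le_mul_of_nonneg_left (by linarith)
          (pow_nonneg hg m)).trans h7) (pow_nonneg hg m)

end EdgeNet

/-! ### Near-extremal outputs force concentrated weights -/

namespace EdgeNet

variable {I : Type} [Fintype I] (N : EdgeNet I)

/-- Features `y p, …, y J` of a single path through the network, up to decreasing them. -/
structure IsChain (N : EdgeNet I) (p J : ℕ) (y : ℕ → I → ℝ) : Prop where
  nonneg : ∀ j i, 0 ≤ y j i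
  le : ∀ j, p ≤ j → j < J → ∀ i, y (j + 1) i ≤ N.step j (y j) 0 i

/-- The total mass, not just the maximum, is bounded. This is what later makes one large coordinate
leave little for the others. -/
theorem IsChain.sum_le {N : EdgeNet I} {p J : ℕ} {y : ℕ → I → ℝ} (h : N.IsChain p J y) {b : ℝ}
    (hb : ∑ i, y p i ≤ b) {j : ℕ} (hj : p ≤ j) (hJ : j ≤ J) :
    ∑ i, y j i ≤ b * N.tail j p := by
  induction j, hj using Nat.le_induction with
  | base => simpa [tail_self] using hb
  | succ j hj ih =>
    have h1 := Finset.sum_le_sum fun i (_ : i ∈ Finset.univ) => h.le j hj hJ i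
    have h2 := N.sum_step_le j (h.nonneg j) (fun s => (Finset.single_le_sum
      (fun i _ => h.nonneg j i) (Finset.mem_univ s)).trans (ih (by omega))) le_rfl
    rw [tail, Finset.prod_Ico_succ_top hj]
    rw [tail] at h2
    linarith

theorem tail_mul_tail {p j J : ℕ} (h : p ≤ j) (h' : j ≤ J) :
    N.tail j p * N.tail J j = N.tail J p := Finset.prod_Ico_consecutive _ h h'

theorem tail_pos_of_le {p j J : ℕ} (h : p ≤ j) (h' : j ≤ J) (hp : 0 < N.tail J p) :
    0 < N.tail j p ∧ 0 < N.tail J j := by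
  rw [← N.tail_mul_tail h h'] at hp
  have := N.tail_nonneg j p
  have := N.tail_nonneg J j
  constructor <;> by_contra! hc <;> nlinarith

/-- If the output of a chain nearly attains the product of the norms, then every layer has a
dominating entry. -/
theorem IsChain.exists_dominant {N : EdgeNet I} {p J : ℕ} {y : ℕ → I → ℝ}
    (h : N.IsChain p J y) {b δ : ℝ} (hpJ : p ≤ J) (hδ : δ ≤ 1 / 8) (hb₀ : 0 < b)
    (hb : ∑ i, y p i ≤ b) (hT : 0 < N.tail J p) {o : I}
    (ho : (1 - δ) * (b * N.tail J p) ≤ y J o) :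
    ∃ i : ℕ → I, i J = o ∧
      (∀ j, p ≤ j → j ≤ J → (1 - δ) * (b * N.tail j p) ≤ y j (i j)) ∧
      ∀ j, p ≤ j → j < J → (1 - 2 * δ) * N.normW j ≤ N.W j (i (j + 1)) (i j) := by
  have hmax : ∀ j, ∃ s₀, ∀ s, y j s ≤ y j s₀ := fun j => by
    have : Nonempty I := ⟨o⟩
    exact Finite.exists_max (y j)
  -- The output is at most the remaining norm product times the largest coordinate of layer `j`; a
  -- nearly extremal output therefore makes that coordinate nearly all of the available mass.
  have hdec : ∀ l j, p ≤ j → j + l = J → ∀ s₀, (∀ s, y j s ≤ y j s₀) →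
      ∀ s, y J s ≤ N.tail J j * y j s₀ := by
    intro l
    induction l with
    | zero => intro j _ hj s₀ hs s; simpa [← hj, tail_self] using hs s
    | succ l ih =>
      intro j hpj hj s₀ hs s
      obtain ⟨s₁, hs₁⟩ := hmax (j + 1)
      have h1 := ih (j + 1) (by omega) (by omega) s₁ hs₁ s
      have h2 := (h.le j hpj (by omega) s₁).trans (N.step_le j (h.nonneg j) hs le_rfl s₁)
      have h3 := mul_le_mul_of_nonneg_left h2 (N.tail_nonneg J (j + 1))
      rw [N.tail_eq_mul (by omega)]
      linarith
  have hex : ∀ j, ∃ s, (j = J → s = o) ∧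
      (p ≤ j → j ≤ J → (1 - δ) * (b * N.tail j p) ≤ y j s) := by
    intro j
    by_cases hj : j = J
    · subst hj; exact ⟨o, fun _ => rfl, fun _ _ => ho⟩
    · obtain ⟨s, hs⟩ := hmax j
      refine ⟨s, fun h => absurd h hj, fun h1 h2 => ?_⟩
      have h3 := ho.trans (hdec (J - j) j h1 (by omega) s hs o)
      rw [← N.tail_mul_tail h1 h2] at h3
      refine le_of_mul_le_mul_left ?_ (N.tail_pos_of_le h1 h2 hT).2
      linarith
  choose i hi₁ hi₂ using hex
  refine ⟨i, hi₁ J rfl, hi₂, fun j h1 h2 => ?_⟩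
  have hj := hi₂ j h1 h2.le
  have hj1 := (hi₂ (j + 1) (by omega) h2).trans (h.le j h1 h2 (i (j + 1)))
  have hB : 0 < b * N.tail j p := mul_pos hb₀ (N.tail_pos_of_le h1 h2.le hT).1
  have hω : 0 < N.normW j := by
    have := (N.tail_pos_of_le h1 h2.le hT).2
    rw [N.tail_eq_mul h2] at this
    have h3 := N.tail_nonneg J (j + 1)
    have h4 := N.normW_nonneg j
    by_contra! hc
    nlinarith
  have hsum := h.sum_le hb h1 h2.le
  have hsucc : N.tail (j + 1) p = N.tail j p * N.normW j := Finset.prod_Ico_succ_top h1 _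
  rw [hsucc] at hj1
  set B := b * N.tail j p with hBdef
  have hsmall : ∀ s ≠ i j, y j s ≤ δ * B := fun s hs => by
    classical
    have : y j s + y j (i j) ≤ ∑ s, y j s := by
      rw [← Finset.sum_pair hs]
      exact Finset.sum_le_sum_of_subset_of_nonneg (Finset.subset_univ _)
        fun r _ _ => h.nonneg j r
    linarith
  have hbig : y j (i j) ≤ B :=
    (Finset.single_le_sum (fun r _ => h.nonneg j r) (Finset.mem_univ _)).trans hsum
  have hrow : ∑ s, |N.W j (i (j + 1)) s| ≤ N.normW j :=
    Finset.single_le_sum (f := fun r => ∑ s, |N.W j r s|)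
      (fun r _ => Finset.sum_nonneg fun _ _ => abs_nonneg _) (Finset.mem_univ _)
  set a := i (j + 1)
  set c := i j
  have hδ₀ : 0 ≤ δ := by nlinarith
  -- The off-chain coordinates contribute at most `δ B` times the norm. Together with the loss `δ`
  -- in `hj1` this gives the `2δ`.
  have hle : ∑ s, N.W j a s * y j s ≤ max 0 (N.W j a c) * B + δ * B * N.normW j := by
    classical
    rw [← Finset.add_sum_erase _ _ (Finset.mem_univ c)]
    refine add_le_add ?_ ?_
    · exact (mul_le_mul_of_nonneg_right (le_max_right 0 _) (h.nonneg j c)).trans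
        (mul_le_mul_of_nonneg_left hbig (le_max_left _ _))
    · refine le_trans ?_ (mul_le_mul_of_nonneg_left hrow (mul_nonneg hδ₀ hB.le))
      rw [Finset.mul_sum]
      refine le_trans (Finset.sum_le_sum (g := fun s => δ * B * |N.W j a s|) fun s hs => ?_)
        (Finset.sum_le_sum_of_subset_of_nonneg (Finset.erase_subset _ _) fun s _ _ =>
          mul_nonneg (mul_nonneg hδ₀ hB.le) (abs_nonneg _))
      rw [mul_comm (δ * B)]
      exact (mul_le_mul_of_nonneg_right (le_abs_self _) (h.nonneg j s)).trans
        (mul_le_mul_of_nonneg_left (hsmall s (Finset.ne_of_mem_erase hs)) (abs_nonneg _))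
  have hfin : (1 - δ) * (B * N.normW j) ≤ max 0 (N.W j a c) * B + δ * B * N.normW j := by
    refine le_trans (le_trans (le_of_eq ?_) hj1) (max_le ?_ ?_)
    · rw [hBdef]; ring
    · exact add_nonneg (mul_nonneg (le_max_left _ _) hB.le)
        (mul_nonneg (mul_nonneg hδ₀ hB.le) hω.le)
    · simpa using hle
  have hmaxW : (1 - 2 * δ) * N.normW j ≤ max 0 (N.W j a c) := by
    refine le_of_mul_le_mul_right ?_ hB
    linarith
  rcases le_max_iff.1 hmaxW with h0 | h0
  · have : 0 < (1 - 2 * δ) * N.normW j := mul_pos (by linarith) hω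
    linarith
  · exact h0

/-- Two different columns cannot both hold three quarters of the norm. This glues the chains of
units obtained from different training paths. -/
theorem entry_unique {j : ℕ} {γ : ℝ} (hγ : γ ≤ 1 / 4) (hω : 0 < N.normW j) {a b a' b' : I}
    (h : (1 - γ) * N.normW j ≤ N.W j a b) (h' : (1 - γ) * N.normW j ≤ N.W j a' b') :
    b = b' := by
  classical
  by_contra hne
  have hcol : ∀ b, N.W j a b ≤ ∑ r, |N.W j r b| := fun b => (le_abs_self _).trans
    (Finset.single_le_sum (f := fun r => |N.W j r b|) (fun _ _ => abs_nonneg _)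
      (Finset.mem_univ _))
  have hcol' : N.W j a' b' ≤ ∑ r, |N.W j r b'| := (le_abs_self _).trans
    (Finset.single_le_sum (f := fun r => |N.W j r b'|) (fun _ _ => abs_nonneg _)
      (Finset.mem_univ _))
  have : ∑ r, |N.W j r b| + ∑ r, |N.W j r b'| ≤ N.normW j := by
    rw [normW, Finset.sum_comm, ← Finset.sum_pair hne (f := fun b => ∑ r, |N.W j r b|)]
    exact Finset.sum_le_sum_of_subset_of_nonneg (Finset.subset_univ _)
      fun r _ _ => Finset.sum_nonneg fun _ _ => abs_nonneg _
  nlinarith [hcol b]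

end EdgeNet

theorem BFInstance.mem_nbhd (G : BFInstance) {u v : G.V} :
    u ∈ G.nbhd v ↔ u = v ∨ G.graph.Adj v u := by
  simp [nbhd]

/-! ### Following the network along a walk; outputs on the training paths -/

namespace EdgeNet

variable {I : Type} [Fintype I] (N : EdgeNet I)

theorem step_eq_of_edge_eq_zero {j : ℕ} (h : N.E j = 0) (y : I → ℝ) (e e' : ℝ) :
    N.step j y e = N.step j y e' := by
  funext i; simp [step, h]

/-- The features met when the network is followed along the walk `q 0, q 1, …`. -/
noncomputable def walkSeq (N : EdgeNet I) (m : ℕ) (o : I) (G : BFInstance) (q : ℕ → G.V)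
    (j : ℕ) : I → ℝ :=
  if j % (2 * m) < m then
    N.run (2 * m * (j / (2 * m))) (N.feat m o G (j / (2 * m)) (q (j / (2 * m))))
      (G.weight (q (j / (2 * m) + 1)) (q (j / (2 * m)))) (j % (2 * m))
  else
    N.run (2 * m * (j / (2 * m)) + m)
      (N.aggMin m G (j / (2 * m)) (N.feat m o G (j / (2 * m))) (q (j / (2 * m) + 1))) 0
      (j % (2 * m) - m)

theorem walkSeq_nonneg (m : ℕ) (o : I) (G : BFInstance) (q : ℕ → G.V) (j : ℕ) (i : I) :
    0 ≤ N.walkSeq m o G q j i := by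
  unfold walkSeq
  split_ifs
  · exact N.run_nonneg _ (N.feat_nonneg _ _ _ _ _) _ _ _
  · exact N.run_nonneg _ (N.aggMin_nonneg _ _ _ (N.feat_nonneg _ _ _ _) _) _ _ _

theorem walkSeq_add (m : ℕ) (o : I) (G : BFInstance) (q : ℕ → G.V) (t : ℕ) {l : ℕ}
    (hl : l < 2 * m) : N.walkSeq m o G q (2 * m * t + l) =
      if l < m then
        N.run (2 * m * t) (N.feat m o G t (q t)) (G.weight (q (t + 1)) (q t)) l
      else N.run (2 * m * t + m) (N.aggMin m G t (N.feat m o G t) (q (t + 1))) 0 (l - m) := by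
  have h1 : (2 * m * t + l) / (2 * m) = t := by
    rw [Nat.mul_add_div (by omega), Nat.div_eq_of_lt hl, add_zero]
  have h2 : (2 * m * t + l) % (2 * m) = l := by
    rw [Nat.mul_add_mod, Nat.mod_eq_of_lt hl]
  rw [walkSeq, h1, h2]

theorem walkSeq_mul {m : ℕ} (hm : 1 ≤ m) (o : I) (G : BFInstance) (q : ℕ → G.V) (t : ℕ) :
    N.walkSeq m o G q (2 * m * t) = N.feat m o G t (q t) := by
  have := N.walkSeq_add m o G q t (l := 0) (by omega)
  rw [add_zero, if_pos (by omega)] at this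
  exact this

/-- Equality holds at every layer except the last one of an aggregation network, where the minimum
is bounded by the message of the walk's own vertex. -/
theorem walkSeq_succ_le {m K : ℕ} (hm : 1 ≤ m) (o : I)
    (hE : ∀ t q, 0 < q → q < 2 * m → N.E (2 * m * t + q) = 0)
    (G : BFInstance) (q : ℕ → G.V) (hq : ∀ t < K, q t ∈ G.nbhd (q (t + 1)))
    {t l : ℕ} (ht : t < K) (hl : l < 2 * m) (i : I) :
    N.walkSeq m o G q (2 * m * t + l + 1) i ≤
      N.step (2 * m * t + l) (N.walkSeq m o G q (2 * m * t + l))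
        (G.weight (q (t + 1)) (q t)) i := by
  rw [N.walkSeq_add m o G q t hl]
  rcases lt_trichotomy (l + 1) m with h | h | h
  · rw [add_assoc, N.walkSeq_add m o G q t (by omega), if_pos h, if_pos (by omega)]
    exact le_rfl
  · rw [add_assoc, N.walkSeq_add m o G q t (by omega), if_neg (by omega), if_pos (by omega), h,
      Nat.sub_self]
    have hrun : ∀ p y e, N.run p y e m = N.step (p + l) (N.run p y e l) e := fun p y e => by
      rw [← h, run]
    exact (N.aggMin_le m G t _ (hq t ht) i).trans (le_of_eq (by rw [hrun]))
  · rw [N.step_eq_of_edge_eq_zero (hE t l (by omega) hl) _ _ 0, if_neg (by omega)]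
    obtain ⟨l', rfl⟩ : ∃ l', l = m + l' := ⟨l - m, by omega⟩
    rw [Nat.add_sub_cancel_left, ← add_assoc]
    by_cases h' : m + l' + 1 = 2 * m
    · have h2 : 2 * m * t + m + l' + 1 = 2 * m * (t + 1) := by rw [Nat.mul_succ]; omega
      have h3 : m = l' + 1 := by omega
      rw [h2, N.walkSeq_mul hm, feat]
      have hrun : ∀ p y e, N.run p y e m = N.step (p + l') (N.run p y e l') e :=
        fun p y e => by rw [h3, run]
      exact le_of_eq (congrFun (hrun _ _ _) i)
    · rw [add_assoc, add_assoc, N.walkSeq_add m o G q t (by omega), if_neg (by omega)]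
      refine le_of_eq ?_
      rw [show m + (l' + 1) - m = l' + 1 by omega]
      rfl

theorem exists_add_of_lt {m K j : ℕ} (hj : j < 2 * m * K) :
    ∃ t l, t < K ∧ l < 2 * m ∧ j = 2 * m * t + l := by
  have h0 : 0 < 2 * m := Nat.pos_of_ne_zero fun h => by simp [h] at hj
  exact ⟨j / (2 * m), j % (2 * m), Nat.div_lt_of_lt_mul hj, Nat.mod_lt _ h0,
    (Nat.div_add_mod _ _).symm⟩

section Walk

variable {m K : ℕ} (hm : 1 ≤ m) (o : I)
  (hE : ∀ t q, 0 < q → q < 2 * m → N.E (2 * m * t + q) = 0)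
  (G : BFInstance) (q : ℕ → G.V) (hq : ∀ t < K, q t ∈ G.nbhd (q (t + 1)))

include hm hE hq

theorem isChain_walkSeq {p : ℕ}
    (he : ∀ t < K, p ≤ 2 * m * t → G.weight (q (t + 1)) (q t) = 0) :
    N.IsChain p (2 * m * K) (N.walkSeq m o G q) := by
  refine ⟨N.walkSeq_nonneg m o G q, fun j hp hj i => ?_⟩
  obtain ⟨t, l, ht, hl, rfl⟩ := exists_add_of_lt hj
  refine (N.walkSeq_succ_le hm o hE G q hq ht hl i).trans (le_of_eq ?_)
  rcases Nat.eq_zero_or_pos l with rfl | h0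
  · rw [he t ht (by omega), NNReal.coe_zero]
  · rw [N.step_eq_of_edge_eq_zero (hE t l h0 hl)]

/-- Without biases, nothing enters the walk before its first positive weight. For x e_{t+1} the
chain thus starts at the edge column of step `t + 1`. -/
theorem walkSeq_eq_zero (hlab : G.label (q 0) = 0) {t : ℕ} (ht : t < K)
    (he : ∀ t' < t, G.weight (q (t' + 1)) (q t') = 0) :
    N.walkSeq m o G q (2 * m * t) = 0 := by
  have hmul := Nat.mul_le_mul_left (2 * m) ht.le
  have key : ∀ j, j ≤ 2 * m * t → N.walkSeq m o G q j = 0 := by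
    intro j
    induction j with
    | zero =>
      intro _
      have := N.walkSeq_mul hm o G q 0
      rw [mul_zero] at this
      rw [this]
      funext i
      simp [feat, hlab]
    | succ j ih =>
      intro hj
      obtain ⟨t', l, ht', hl, rfl⟩ := exists_add_of_lt (show j < 2 * m * t by omega)
      funext i
      refine le_antisymm ((N.walkSeq_succ_le hm o hE G q hq (ht'.trans ht) hl i).trans ?_)
        (N.walkSeq_nonneg m o G q _ i)
      rw [ih (by omega), he t' ht']
      simp [step]
  exact key _ le_rfl

theorem walkSeq_edge_le (hlab : G.label (q 0) = 0) {t : ℕ} (ht : t < K)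
    (he : ∀ t' < t, G.weight (q (t' + 1)) (q t') = 0) (i : I) :
    N.walkSeq m o G q (2 * m * t + 1) i ≤
      max 0 (N.E (2 * m * t) i * G.weight (q (t + 1)) (q t)) := by
  refine (N.walkSeq_succ_le hm o hE G q hq ht (l := 0) (by omega) i).trans (le_of_eq ?_)
  rw [add_zero, N.walkSeq_eq_zero hm o hE G q hq hlab ht he]
  simp [step]

theorem sum_walkSeq_edge_le (hlab : G.label (q 0) = 0) {t : ℕ} (ht : t < K)
    (he : ∀ t' < t, G.weight (q (t' + 1)) (q t') = 0) :
    ∑ i, N.walkSeq m o G q (2 * m * t + 1) i ≤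
      N.normE (2 * m * t) * G.weight (q (t + 1)) (q t) := by
  rw [normE, Finset.sum_mul]
  refine Finset.sum_le_sum fun i _ =>
    (N.walkSeq_edge_le hm o hE G q hq hlab ht he i).trans (max_le (by positivity) ?_)
  exact mul_le_mul_of_nonneg_right (le_abs_self _) (NNReal.coe_nonneg _)

end Walk

theorem sum_walkSeq_zero {m : ℕ} (hm : 1 ≤ m) (o : I) (G : BFInstance) (q : ℕ → G.V) :
    ∑ i, N.walkSeq m o G q 0 i = G.label (q 0) := by
  have := N.walkSeq_mul hm o G q 0
  rw [mul_zero] at this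
  rw [this]
  exact (Finset.sum_eq_single o (fun i _ hi => if_neg hi)
    fun h => absurd (Finset.mem_univ o) h).trans (if_pos rfl)

/-- The vertex `v_n` of a path. -/
def pathVertex (K : ℕ) (β : ℝ≥0) (w : Fin (K + 1) → ℝ≥0) (n : ℕ) :
    (BFInstance.path K β w).V := (⟨min n K, by omega⟩ : Fin (K + 1))

theorem pathVertex_adj {K t : ℕ} (ht : t < K) :
    (SimpleGraph.pathGraph (K + 1)).Adj ⟨min (t + 1) K, by omega⟩ ⟨min t K, by omega⟩ := by
  rw [SimpleGraph.pathGraph_adj]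
  right
  simp only
  omega

theorem pathVertex_mem {K : ℕ} (β : ℝ≥0) (w : Fin (K + 1) → ℝ≥0) {t : ℕ} (ht : t < K) :
    pathVertex K β w t ∈ (BFInstance.path K β w).nbhd (pathVertex K β w (t + 1)) :=
  (BFInstance.mem_nbhd _).2 (Or.inr (pathVertex_adj ht))

theorem path_weight {K : ℕ} (β : ℝ≥0) (w : Fin (K + 1) → ℝ≥0) {t : ℕ} (ht : t < K) :
    (BFInstance.path K β w).weight (pathVertex K β w (t + 1)) (pathVertex K β w t) =
      w ⟨t + 1, by omega⟩ := by
  refine (if_pos (pathVertex_adj ht)).trans (congrArg w ?_)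
  refine (max_eq_left (Fin.le_def.2 ?_)).trans (Fin.ext ?_)
  · exact min_le_min_right K (Nat.le_succ t)
  · exact min_eq_left ht

theorem path_label_zero {K : ℕ} (β : ℝ≥0) (w : Fin (K + 1) → ℝ≥0) :
    (BFInstance.path K β w).label (pathVertex K β w 0) = w 0 :=
  have h : (⟨min 0 K, by omega⟩ : Fin (K + 1)) = 0 := Fin.ext (Nat.zero_min K)
  (if_pos h : (if (⟨min 0 K, by omega⟩ : Fin (K + 1)) = 0 then w 0 else β) = w 0)

/-- The output on the path with weight vector `x e_k`. -/
noncomputable def pathOut (N : EdgeNet I) (m K : ℕ) (o : I) (β x : ℝ≥0) (k : Fin (K + 1)) : ℝ :=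
  N.feat m o (BFInstance.path K β (Pi.single k x)) K (Fin.last K : Fin (K + 1)) o

theorem pathVertex_last (K : ℕ) (β : ℝ≥0) (w : Fin (K + 1) → ℝ≥0) :
    pathVertex K β w K = (Fin.last K : Fin (K + 1)) := by
  exact Fin.ext (min_self K)

section PathOut

variable {m K : ℕ} (hm : 1 ≤ m) (o : I)
  (hE : ∀ t q, 0 < q → q < 2 * m → N.E (2 * m * t + q) = 0) (β x : ℝ≥0)

include hm

theorem pathOut_eq_walkSeq (k : Fin (K + 1)) : N.pathOut m K o β x k =
    N.walkSeq m o (BFInstance.path K β (Pi.single k x))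
      (pathVertex K β (Pi.single k x)) (2 * m * K) o := by
  rw [N.walkSeq_mul hm, pathVertex_last]; rfl

theorem path_zero_sum :
    ∑ i, N.walkSeq m o (BFInstance.path K β (Pi.single 0 x))
      (pathVertex K β (Pi.single 0 x)) 0 i = x := by
  rw [N.sum_walkSeq_zero hm, path_label_zero, Pi.single_eq_same]

include hE

theorem path_zero_chain :
    N.IsChain 0 (2 * m * K) (N.walkSeq m o (BFInstance.path K β (Pi.single 0 x))
      (pathVertex K β (Pi.single 0 x))) :=
  N.isChain_walkSeq hm o hE _ _ (fun _ ht => pathVertex_mem β _ ht) fun t ht _ => by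
    rw [path_weight β _ ht, Pi.single_eq_of_ne]
    simp [Fin.ext_iff]

theorem path_succ_chain {t : ℕ} (ht : t < K) :
    N.IsChain (2 * m * t + 1) (2 * m * K)
      (N.walkSeq m o (BFInstance.path K β (Pi.single ⟨t + 1, by omega⟩ x))
        (pathVertex K β (Pi.single ⟨t + 1, by omega⟩ x))) :=
  N.isChain_walkSeq hm o hE _ _ (fun _ ht => pathVertex_mem β _ ht) fun t' ht' h => by
    rw [path_weight β _ ht', Pi.single_eq_of_ne]
    have : t' ≠ t := by rintro rfl; omega
    simpa [Fin.ext_iff] using this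

theorem path_succ_edge {t : ℕ} (ht : t < K) :
    (∀ i, N.walkSeq m o (BFInstance.path K β (Pi.single ⟨t + 1, by omega⟩ x))
        (pathVertex K β (Pi.single ⟨t + 1, by omega⟩ x)) (2 * m * t + 1) i ≤
      max 0 (N.E (2 * m * t) i * x)) ∧
    ∑ i, N.walkSeq m o (BFInstance.path K β (Pi.single ⟨t + 1, by omega⟩ x))
        (pathVertex K β (Pi.single ⟨t + 1, by omega⟩ x)) (2 * m * t + 1) i ≤
      N.normE (2 * m * t) * x := by
  have hlab : (BFInstance.path K β (Pi.single ⟨t + 1, by omega⟩ x)).label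
      (pathVertex K β (Pi.single ⟨t + 1, by omega⟩ x) 0) = 0 := by
    rw [path_label_zero, Pi.single_eq_of_ne]
    simp [Fin.ext_iff]
  have he : ∀ t' < t, (BFInstance.path K β (Pi.single ⟨t + 1, by omega⟩ x)).weight
      (pathVertex K β (Pi.single ⟨t + 1, by omega⟩ x) (t' + 1))
      (pathVertex K β (Pi.single ⟨t + 1, by omega⟩ x) t') = 0 := fun t' h => by
    rw [path_weight β _ (h.trans ht), Pi.single_eq_of_ne]
    simpa [Fin.ext_iff] using h.ne
  have h1 := N.walkSeq_edge_le hm o hE _ _ (fun _ ht => pathVertex_mem β _ ht) hlab ht he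
  have h2 := N.sum_walkSeq_edge_le hm o hE _ _ (fun _ ht => pathVertex_mem β _ ht) hlab ht he
  rw [path_weight β _ ht, Pi.single_eq_same] at h1 h2
  exact ⟨h1, h2⟩

theorem pathOut_zero_le : N.pathOut m K o β x 0 ≤ x * N.tail (2 * m * K) 0 := by
  rw [N.pathOut_eq_walkSeq hm]
  exact (Finset.single_le_sum (fun i _ => N.walkSeq_nonneg m o _ _ _ i)
    (Finset.mem_univ o)).trans ((N.path_zero_chain hm o hE β x).sum_le
      (N.path_zero_sum hm o β x).le (Nat.zero_le _) le_rfl)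

theorem pathOut_succ_le {t : ℕ} (ht : t < K) :
    N.pathOut m K o β x ⟨t + 1, by omega⟩ ≤
      N.normE (2 * m * t) * x * N.tail (2 * m * K) (2 * m * t + 1) := by
  rw [N.pathOut_eq_walkSeq hm]
  have := layer_index_bound (m := m) ht
  exact (Finset.single_le_sum (fun i _ => N.walkSeq_nonneg m o _ _ _ i)
    (Finset.mem_univ o)).trans ((N.path_succ_chain hm o hE β x ht).sum_le
      (N.path_succ_edge hm o hE β x ht).2 (by omega) le_rfl)

/-- The path x e_0 runs through all layers and fixes the units and the matrix entries. The path x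
e_{t+1} starts at an edge column and shows that this column concentrates on one unit, which must be
the unit already fixed. -/
theorem exists_dominant_of_pathOut {δ : ℝ} (hδ₀ : 0 ≤ δ) (hδ : δ ≤ 1 / 8) (hx : 0 < x)
    (hT : 0 < N.tail (2 * m * K) 0) (hc : ∀ t < K, 0 < N.normE (2 * m * t))
    (h₀ : (1 - δ) * (x * N.tail (2 * m * K) 0) ≤ N.pathOut m K o β x 0)
    (h₁ : ∀ t (ht : t < K), (1 - δ) *
      (N.normE (2 * m * t) * x * N.tail (2 * m * K) (2 * m * t + 1)) ≤
        N.pathOut m K o β x ⟨t + 1, by omega⟩) :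
    ∃ i : ℕ → I, i 0 = o ∧ i (2 * m * K) = o ∧ N.Dominant (2 * m * K) (2 * δ) i := by
  have hx' : (0 : ℝ) < x := hx
  rw [N.pathOut_eq_walkSeq hm] at h₀
  obtain ⟨i, hiJ, hi, hW⟩ := (N.path_zero_chain hm o hE β x).exists_dominant (Nat.zero_le _) hδ
    hx' (N.path_zero_sum hm o β x).le hT h₀
  refine ⟨i, ?_, hiJ, fun j hj => hW j (Nat.zero_le _) hj, fun j hj => ?_⟩
  -- The input feature is supported on `o`, so any other unit would carry 0.
  · by_contra hne
    have h := hi 0 le_rfl (Nat.zero_le _)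
    have h' := N.walkSeq_mul hm o (BFInstance.path K β (Pi.single 0 x))
      (pathVertex K β (Pi.single 0 x)) 0
    rw [mul_zero] at h'
    rw [h', tail_self] at h
    simp only [feat, if_neg hne] at h
    nlinarith
  · obtain ⟨t, l, ht, hl, rfl⟩ := exists_add_of_lt hj
    rcases Nat.eq_zero_or_pos l with rfl | h0
    · rw [add_zero] at hj ⊢
      have hb := layer_index_bound (m := m) ht
      have hT' := (N.tail_pos_of_le (Nat.zero_le (2 * m * t + 1)) hj hT).2
      have h₂ := h₁ t ht
      rw [N.pathOut_eq_walkSeq hm] at h₂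
      obtain ⟨i', -, hi', hW'⟩ := (N.path_succ_chain hm o hE β x ht).exists_dominant hj hδ
        (mul_pos (hc t ht) hx') (N.path_succ_edge hm o hE β x ht).2 hT' h₂
      have hlt : 2 * m * t + 1 < 2 * m * K := by omega
      have hω : 0 < N.normW (2 * m * t + 1) := by
        rw [N.tail_eq_mul hlt] at hT'
        exact pos_of_mul_pos_left hT' (N.tail_nonneg _ _)
      -- Both chains dominate the matrix right after the edge layer, which exists since `2 * m ≥ 2`;
      -- its dominating column is the unit where the edge weight arrives.
      have heq := N.entry_unique (γ := 2 * δ) (by linarith) hω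
        (hW _ (Nat.zero_le _) hlt) (hW' _ le_rfl hlt)
      have h3 := (hi' _ le_rfl hj).trans ((N.path_succ_edge hm o hE β x ht).1 _)
      rw [← heq, tail_self, mul_one, ← mul_assoc] at h3
      have hcp := hc t ht
      rcases le_max_iff.1 h3 with h4 | h4
      · have : 0 < (1 - δ) * N.normE (2 * m * t) * x :=
          mul_pos (mul_pos (by linarith) hcp) hx'
        linarith
      · have := le_of_mul_le_mul_right h4 hx'
        nlinarith
    · rw [N.normE_eq_zero (hE t l h0 hl), hE t l h0 hl]; simp

end PathOut

end EdgeNet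

/-! ### Distances on the training paths -/

/-- A walk into the part from `k` on must cross the edge of weight x, and all labels already there
are at least x. -/
theorem le_dist_path {K : ℕ} {β x : ℝ≥0} (hβ : x ≤ β) (k : Fin (K + 1)) (t : ℕ)
    (i : Fin (K + 1)) (hi : k ≤ i) :
    x ≤ (BFInstance.path K β (Pi.single k x)).dist t i := by
  induction t generalizing i with
  | zero =>
    change x ≤ if i = 0 then (Pi.single k x : Fin (K + 1) → ℝ≥0) 0 else β
    split_ifs with h
    · have : k = 0 := by rw [h] at hi; exact Fin.le_zero_iff.1 hi
      rw [this, Pi.single_eq_same]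
    · exact hβ
  | succ t ih =>
    refine (Finset.le_inf' _ _ fun (u : Fin (K + 1)) hu => ?_).trans_eq
      (BFInstance.dist_succ (BFInstance.path K β (Pi.single k x)) t i).symm
    rcases le_or_gt k u with h | h
    · exact (ih u h).trans le_self_add
    · have hadj : (SimpleGraph.pathGraph (K + 1)).Adj u i := by
        rcases ((BFInstance.path K β (Pi.single k x)).mem_nbhd).1 hu with hu | hu
        · have hu : u = i := hu
          rw [hu] at h; exact absurd hi (not_le.2 h)
        · exact SimpleGraph.Adj.symm hu
      have hw : (BFInstance.path K β (Pi.single k x)).weight u i = x := by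
        refine (if_pos hadj).trans ?_
        have : i = k := by
          rw [SimpleGraph.pathGraph_adj] at hadj
          rw [Fin.lt_def] at h
          rw [Fin.le_def] at hi
          rw [Fin.ext_iff]
          omega
        rw [max_eq_right (h.le.trans hi), this, Pi.single_eq_same]
      rw [hw]
      exact le_add_self

/-- Needed so that the K + 1 paths contribute K + 1 separate terms to the empirical loss. -/
theorem path_training_injective {K : ℕ} (β : ℝ≥0) {x : ℝ≥0} (hx : x ≠ 0) :
    Function.Injective fun k : Fin (K + 1) =>
      (⟨BFInstance.path K β (Pi.single k x), Fin.last K⟩ : BFVertex) := by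
  intro k k' h
  by_contra hne
  have hG : BFInstance.path K β (Pi.single k x) = BFInstance.path K β (Pi.single k' x) :=
    (Sigma.mk.inj_iff.1 h).1
  simp only [BFInstance.path, BFInstance.mk.injEq, heq_eq_eq, true_and] at hG
  obtain ⟨h1, h2⟩ := hG
  rcases Fin.eq_zero_or_eq_succ k with rfl | ⟨l, rfl⟩
  · have := congrFun h1 0
    simp only [if_true, Pi.single_eq_same, Pi.single_eq_of_ne hne] at this
    exact hx this
  · have := congrFun (congrFun h2 l.castSucc) l.succ
    rw [if_pos (by rw [SimpleGraph.pathGraph_adj]; left; simp), if_pos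
      (by rw [SimpleGraph.pathGraph_adj]; left; simp),
      max_eq_right (Fin.castSucc_lt_succ).le, Pi.single_eq_same, Pi.single_eq_of_ne hne] at this
    exact hx this

/-! ### Zero padding: the MPNN as a uniform-width network -/

/-- Extension of a vector by zero. -/
def extendZero (d : ℕ) {n : ℕ} (f : Fin n → ℝ) : Fin d → ℝ :=
  fun r => if h : r.val < n then f ⟨r, h⟩ else 0

theorem sum_extendZero {d n : ℕ} (h : n ≤ d) (f : Fin n → ℝ) :
    ∑ r, extendZero d f r = ∑ r, f r := by
  have h1 := Fin.sum_univ_eq_sum_range (fun r => if h : r < n then f ⟨r, h⟩ else 0) d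
  have h2 := Fin.sum_univ_eq_sum_range (fun r => if h : r < n then f ⟨r, h⟩ else 0) n
  simp only [Fin.is_lt, dif_pos, Fin.eta] at h2
  rw [h2]
  refine h1.trans (Finset.sum_subset (Finset.range_subset_range.2 h) fun r _ hr => ?_).symm
  rw [dif_neg (by simpa using hr)]

theorem extendZero_cast (d : ℕ) {n n' : ℕ} (h : n' = n) (f : Fin n → ℝ) :
    extendZero d (fun i => f (Fin.cast h i)) = extendZero d f := by
  subst h; rfl

theorem layerDim_le {K m d : ℕ} (hd : 1 ≤ d) (j : ℕ) : layerDim K m d j ≤ d := by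
  unfold layerDim; split_ifs <;> omega

theorem layerDim_pos {K m d : ℕ} (hd : 1 ≤ d) (j : ℕ) : 0 < layerDim K m d j := by
  unfold layerDim; split_ifs <;> omega

namespace MPNNParams

variable {K m d : ℕ} (θ : MPNNParams K m d)

/-- The network with all features extended by zero to dimension `d`. -/
def toNet : EdgeNet (Fin d) where
  W j r s := extendZero d (fun r' => extendZero d (fun s' => θ.weight j r' s') s) r
  E j := if 2 * m ∣ j then extendZero d (θ.edgeWeight (j / (2 * m))) else 0

theorem toNet_E_eq_zero (t q : ℕ) (hq : 0 < q) (hq' : q < 2 * m) :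
    θ.toNet.E (2 * m * t + q) = 0 := by
  refine if_neg fun h => ?_
  rw [Nat.dvd_add_right (dvd_mul_right _ _)] at h
  exact absurd (Nat.le_of_dvd hq h) (by omega)

theorem toNet_E_mul (hm : 1 ≤ m) (t : ℕ) :
    θ.toNet.E (2 * m * t) = extendZero d (θ.edgeWeight t) := by
  refine (if_pos (dvd_mul_right _ _)).trans ?_
  exact congrArg (fun t => extendZero d (θ.edgeWeight t)) (Nat.mul_div_cancel_left t (by omega))

variable (hd : 1 ≤ d)

include hd

theorem sum_toNet_W (j : ℕ) (y : Fin (layerDim K m d j) → ℝ) (r : Fin d) :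
    ∑ s, θ.toNet.W j r s * extendZero d y s = extendZero d ((θ.weight j).mulVec y) r := by
  by_cases hr : r.val < layerDim K m d (j + 1)
  · have : ∀ s, θ.toNet.W j r s * extendZero d y s =
        extendZero d (fun s => θ.weight j ⟨r, hr⟩ s * y s) s := fun s => by
      simp only [toNet, extendZero, dif_pos hr]
      split_ifs <;> simp
    rw [Finset.sum_congr rfl fun s _ => this s, sum_extendZero (layerDim_le hd j)]
    simp [extendZero, dif_pos hr, Matrix.mulVec, dotProduct]
  · simp [toNet, extendZero, dif_neg hr]

theorem toNet_normW (j : ℕ) : θ.toNet.normW j = θ.normW (j + 1) := by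
  change _ = ∑ r, ∑ s, |θ.weight j r s|
  have h1 : ∀ r, ∑ s, |θ.toNet.W j r s| =
      extendZero d (fun r => ∑ s, |θ.weight j r s|) r := fun r => by
    by_cases hr : r.val < layerDim K m d (j + 1)
    · have : ∀ s, |θ.toNet.W j r s| = extendZero d (fun s => |θ.weight j ⟨r, hr⟩ s|) s := by
        intro s
        simp only [toNet, extendZero, dif_pos hr]
        split_ifs <;> simp
      rw [Finset.sum_congr rfl fun s _ => this s, sum_extendZero (layerDim_le hd j)]
      simp [extendZero, dif_pos hr]
    · simp [toNet, extendZero, dif_neg hr]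
  rw [EdgeNet.normW, Finset.sum_congr rfl fun r _ => h1 r, sum_extendZero (layerDim_le hd _)]

theorem toNet_normE (hm : 1 ≤ m) (t : ℕ) :
    θ.toNet.normE (2 * m * t) = ∑ r, |θ.edgeWeight t r| := by
  rw [EdgeNet.normE, θ.toNet_E_mul hm,
    ← sum_extendZero (layerDim_le hd _) fun r => |θ.edgeWeight t r|]
  refine Finset.sum_congr rfl fun r _ => ?_
  unfold extendZero
  split_ifs <;> simp

theorem extendZero_fnn (p : ℕ) (y : Fin (layerDim K m d p) → ℝ) (l : ℕ) :
    extendZero d (θ.fnn p y l) = θ.toNet.run p (extendZero d y) 0 l := by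
  induction l with
  | zero => rfl
  | succ l ih =>
    funext r
    rw [EdgeNet.run, EdgeNet.step, ← ih, mul_zero, add_zero, θ.sum_toNet_W hd (p + l)]
    simp only [extendZero, fnn]
    split_ifs with h1 h2 h2
    · rfl
    · exact absurd h1 h2
    · exact absurd h2 h1
    · simp

theorem extendZero_agg (hm : 1 ≤ m) (t : ℕ) (y : Fin (layerDim K m d (2 * m * t)) → ℝ) (e : ℝ)
    {l : ℕ} (hl : l ≤ m) :
    extendZero d (θ.agg t y e l) = θ.toNet.run (2 * m * t) (extendZero d y) e l := by
  induction l with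
  | zero => rfl
  | succ l ih =>
    funext r
    rw [EdgeNet.run, EdgeNet.step, ← ih (by omega), θ.sum_toNet_W hd (2 * m * t + l)]
    cases l with
    | zero =>
      have h : θ.toNet.E (2 * m * t + 0) = _ := θ.toNet_E_mul hm t
      rw [h]
      simp only [extendZero, agg]
      by_cases hr : r.val < layerDim K m d (2 * m * t + 1)
      · rw [dif_pos hr, dif_pos hr, dif_pos hr]; rfl
      · rw [dif_neg hr, dif_neg hr, dif_neg hr]; simp
    | succ l =>
      rw [θ.toNet_E_eq_zero t (l + 1) (by omega) (by omega)]
      simp only [extendZero, agg, Pi.zero_apply, zero_mul, add_zero]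
      split_ifs with h1 h2 h2
      · rfl
      · exact absurd h1 h2
      · exact absurd h2 h1
      · simp

/-- Padded coordinates stay 0 under ReLU, and a minimum of zeros is 0, so padding commutes with
every operation. -/
theorem extendZero_feature (hm : 1 ≤ m) (G : BFInstance) (t : ℕ) (v : G.V) :
    extendZero d (θ.feature G t v) = θ.toNet.feat m ⟨0, hd⟩ G t v := by
  induction t generalizing v with
  | zero =>
    funext r
    have h : layerDim K m d 0 = 1 := if_pos (Or.inl rfl)
    by_cases hr : r = ⟨0, hd⟩
    · subst hr
      exact (dif_pos (layerDim_pos hd 0)).trans (if_pos rfl).symm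
    · refine (dif_neg ?_).trans (if_neg hr).symm
      rw [Fin.ext_iff] at hr
      simp only [mul_zero, h]
      simp only at hr
      omega
  | succ t ih =>
    simp only [feature, EdgeNet.feat]
    rw [extendZero_cast d _ (θ.fnn (2 * m * t + m) _ m), θ.extendZero_fnn hd]
    congr 1
    funext r
    simp only [EdgeNet.aggMin, ← ih, ← θ.extendZero_agg hd hm t _ _ le_rfl]
    by_cases hr : r.val < layerDim K m d (2 * m * t + m)
    · simp only [extendZero, dif_pos hr]
    · simp only [extendZero, dif_neg hr, Finset.inf'_const]

theorem output_eq_feat (hm : 1 ≤ m) (G : BFInstance) (v : G.V) :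
    θ.output G v = θ.toNet.feat m ⟨0, hd⟩ G K v ⟨0, hd⟩ := by
  rw [← θ.extendZero_feature hd hm]
  rw [output, extendZero, dif_pos (layerDim_pos hd _)]

/-- This grouping matches each block of norms with the product bounding one training path. -/
theorem regLoss_eq (hm : 1 ≤ m) : θ.regLoss =
    ∑ j ∈ Finset.range (2 * m * K), θ.toNet.normW j +
      ∑ t ∈ Finset.range K, (∑ j ∈ Finset.Ico (2 * m * t + 1) (2 * m * K), θ.toNet.normW j +
        θ.toNet.normE (2 * m * t)) := by
  have hshift : ∀ a, ∑ j ∈ Finset.Ioc a (2 * m * K), θ.normW j =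
      ∑ j ∈ Finset.Ico a (2 * m * K), θ.toNet.normW j := fun a => by
    have : Finset.Ioc a (2 * m * K) = Finset.Ico (a + 1) (2 * m * K + 1) := by
      ext; simp only [Finset.mem_Ioc, Finset.mem_Ico]; omega
    rw [this, ← Finset.sum_Ico_add' _ _ _ 1]
    exact Finset.sum_congr rfl fun j _ => (θ.toNet_normW hd j).symm
  have hC : ∑ t : Fin K, ∑ r, |θ.C t r| =
      ∑ t ∈ Finset.range K, θ.toNet.normE (2 * m * t) := by
    rw [← Fin.sum_univ_eq_sum_range (fun t => θ.toNet.normE (2 * m * t)) K]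
    refine Finset.sum_congr rfl fun t _ => ?_
    rw [θ.toNet_normE hd hm]
    simp [edgeWeight]
  rw [regLoss, Finset.sum_range_succ', hC, Finset.sum_add_distrib]
  simp only [hshift, edgeLayer, if_true, Nat.add_eq_zero_iff, one_ne_zero, and_false, if_false,
    Nat.add_sub_cancel, ← Finset.range_eq_Ico]
  ring

/-! ### The exact Bellman–Ford parameters and their loss -/

omit hd

/-- Parameters that implement the Bellman-Ford algorithm: one unit entry in every matrix. -/
def bellmanFord (K m d : ℕ) : MPNNParams K m d where
  W _ r s := if r.val = 0 ∧ s.val = 0 then 1 else 0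
  C _ r := if r.val = 0 then 1 else 0

theorem bellmanFord_W (hd : 1 ≤ d) {j : ℕ} (hj : j < 2 * m * K) (r s : Fin d) :
    (bellmanFord K m d).toNet.W j r s = if r = ⟨0, hd⟩ ∧ s = ⟨0, hd⟩ then 1 else 0 := by
  have h1 := layerDim_pos (K := K) (m := m) hd j
  have h2 := layerDim_pos (K := K) (m := m) hd (j + 1)
  have hw : (bellmanFord K m d).weight j = fun r s => if r.val = 0 ∧ s.val = 0 then 1 else 0 :=
    dif_pos hj
  simp only [toNet, extendZero, hw, Fin.ext_iff]
  by_cases hr : r.val = 0 <;> by_cases hs : s.val = 0 <;> simp [hr, hs, h1, h2]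

theorem bellmanFord_E (hd : 1 ≤ d) (hm : 1 ≤ m) {t : ℕ} (ht : t < K) (r : Fin d) :
    (bellmanFord K m d).toNet.E (2 * m * t) r = if r = ⟨0, hd⟩ then 1 else 0 := by
  have h1 := layerDim_pos (K := K) (m := m) hd (2 * m * t + 1)
  rw [toNet_E_mul _ hm]
  simp only [extendZero, edgeWeight, dif_pos ht, bellmanFord, Fin.ext_iff]
  by_cases hr : r.val = 0 <;> simp [hr, h1]

theorem bellmanFord_normW (hd : 1 ≤ d) {j : ℕ} (hj : j < 2 * m * K) :
    (bellmanFord K m d).toNet.normW j = 1 := by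
  simp only [EdgeNet.normW, bellmanFord_W hd hj]
  rw [Finset.sum_eq_single ⟨0, hd⟩ (fun b _ hb => by simp [hb]) (by simp),
    Finset.sum_eq_single ⟨0, hd⟩ (fun b _ hb => by simp [hb]) (by simp)]
  simp

theorem bellmanFord_normE (hd : 1 ≤ d) (hm : 1 ≤ m) {t : ℕ} (ht : t < K) :
    (bellmanFord K m d).toNet.normE (2 * m * t) = 1 := by
  simp only [EdgeNet.normE, bellmanFord_E hd hm ht]
  rw [Finset.sum_eq_single ⟨0, hd⟩ (fun b _ hb => by simp [hb]) (by simp)]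
  simp

theorem bellmanFord_step (hd : 1 ≤ d) {j : ℕ} (hj : j < 2 * m * K) (y : Fin d → ℝ) (e : ℝ) :
    (bellmanFord K m d).toNet.step j y e ⟨0, hd⟩ =
      max 0 (y ⟨0, hd⟩ + (bellmanFord K m d).toNet.E j ⟨0, hd⟩ * e) := by
  simp only [EdgeNet.step, bellmanFord_W hd hj]
  rw [Finset.sum_eq_single ⟨0, hd⟩ (fun b _ hb => by simp [hb]) (by simp)]
  simp

theorem bellmanFord_run (hd : 1 ≤ d) {p l : ℕ} (hl : 1 ≤ l) (hp : p + l ≤ 2 * m * K)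
    (hE : ∀ q, 0 < q → q < l → (bellmanFord K m d).toNet.E (p + q) = 0)
    {y : Fin d → ℝ} {e c : ℝ} (hy : 0 ≤ y ⟨0, hd⟩)
    (hc : (bellmanFord K m d).toNet.E p ⟨0, hd⟩ * e = c) (hc₀ : 0 ≤ c) :
    (bellmanFord K m d).toNet.run p y e l ⟨0, hd⟩ = y ⟨0, hd⟩ + c := by
  induction l, hl using Nat.le_induction with
  | base =>
    simp only [EdgeNet.run, add_zero]
    rw [bellmanFord_step hd (by omega), hc, max_eq_right (by positivity)]
  | succ l hl ih =>
    rw [EdgeNet.run, bellmanFord_step hd (by omega),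
      ih (by omega) fun q h h' => hE q h (by omega), hE l (by omega) (by omega)]
    simp only [Pi.zero_apply, zero_mul, add_zero]
    exact max_eq_right (by positivity)

theorem bellmanFord_feat (hd : 1 ≤ d) (hm : 1 ≤ m) (G : BFInstance) {t : ℕ} (ht : t ≤ K)
    (v : G.V) :
    (bellmanFord K m d).toNet.feat m ⟨0, hd⟩ G t v ⟨0, hd⟩ = G.dist t v := by
  induction t generalizing v with
  | zero => exact if_pos rfl
  | succ t ih =>
    have hJ := EdgeNet.layer_index_bound (m := m) (Nat.lt_of_succ_le ht)
    have hrun : ∀ u, (bellmanFord K m d).toNet.run (2 * m * t)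
        ((bellmanFord K m d).toNet.feat m ⟨0, hd⟩ G t u) (G.weight v u) m ⟨0, hd⟩ =
          G.dist t u + G.weight v u := fun u => by
      rw [bellmanFord_run hd hm (by omega)
        (fun q h h' => toNet_E_eq_zero _ t q h (by omega)) (EdgeNet.feat_nonneg _ _ _ _ _ _ _)
        (c := (G.weight v u : ℝ)) (by rw [bellmanFord_E hd hm ht, if_pos rfl, one_mul])
        (NNReal.coe_nonneg _), ih (by omega)]
    simp only [EdgeNet.feat]
    rw [bellmanFord_run hd hm hJ
      (fun q h h' => by rw [add_assoc]; exact toNet_E_eq_zero _ t _ (by omega) (by omega))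
      (EdgeNet.aggMin_nonneg _ _ _ _ (EdgeNet.feat_nonneg _ _ _ _ _) _ _)
      (mul_zero _) le_rfl, add_zero]
    simp only [EdgeNet.aggMin, hrun]
    refine le_antisymm ?_ (Finset.le_inf' _ _ fun u hu => G.dist_succ_le t hu)
    obtain ⟨u, hu, h⟩ := G.exists_dist_succ_eq t v
    rw [h]
    exact Finset.inf'_le (fun u => (G.dist t u : ℝ) + G.weight v u) hu

theorem bellmanFord_loss (hd : 1 ≤ d) (hm : 1 ≤ m) (η : ℝ) (X : Finset BFVertex) :
    loss η X (bellmanFord K m d) = η * (2 * m * K +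
      ∑ t ∈ Finset.range K, (2 * m * K - 2 * m * t : ℝ)) := by
  have hemp : empLoss X (bellmanFord K m d) = 0 := by
    rw [empLoss, Finset.sum_eq_zero, mul_zero]
    intro p _
    rw [output_eq_feat _ hd hm, bellmanFord_feat hd hm p.1 le_rfl, sub_self, abs_zero]
  have hW : ∑ j ∈ Finset.range (2 * m * K), (bellmanFord K m d).toNet.normW j = 2 * m * K := by
    rw [Finset.sum_congr rfl fun j hj => bellmanFord_normW hd (Finset.mem_range.1 hj)]
    simp
  rw [loss, hemp, zero_add, regLoss_eq _ hd hm, hW]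
  congr 2
  refine Finset.sum_congr rfl fun t ht => ?_
  have ht := Finset.mem_range.1 ht
  have hJ := EdgeNet.layer_index_bound (m := m) ht
  rw [bellmanFord_normE hd hm ht,
    Finset.sum_congr rfl fun j hj => bellmanFord_normW hd (Finset.mem_Ico.1 hj).2]
  rw [Finset.sum_const, Nat.card_Ico, nsmul_eq_mul, Nat.cast_sub (by omega)]
  push_cast
  ring

end MPNNParams

/-! ### AM-GM and the excess of the loss -/

theorem prod_le_exp_sum_sub_card {ι : Type*} (s : Finset ι) {a : ι → ℝ}
    (ha : ∀ i ∈ s, 0 ≤ a i) : ∏ i ∈ s, a i ≤ Real.exp (∑ i ∈ s, a i - s.card) := by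
  have h : ∑ i ∈ s, a i - s.card = ∑ i ∈ s, (a i - 1) := by simp
  rw [h, Real.exp_sum]
  refine Finset.prod_le_prod ha fun i _ => ?_
  have := Real.add_one_le_exp (a i - 1)
  linarith

/-- Rescale by `ρ`: a smaller sum would make the product less than `ρ ^ s.card ≤ ρ`. -/
theorem card_mul_le_sum_of_le_prod {ι : Type*} (s : Finset ι) {a : ι → ℝ}
    (ha : ∀ i ∈ s, 0 ≤ a i) {ρ : ℝ} (hρ : ρ ≤ 1) (h : ρ ≤ ∏ i ∈ s, a i) :
    s.card * ρ ≤ ∑ i ∈ s, a i := by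
  have hS := Finset.sum_nonneg ha
  rcases le_or_gt ρ 0 with h0 | h0
  · exact (mul_nonpos_of_nonneg_of_nonpos (Nat.cast_nonneg _) h0).trans hS
  · by_contra! hc
    have hcard : s.card ≠ 0 := fun h => by
      rw [h, Nat.cast_zero, zero_mul] at hc
      linarith
    have h1 := prod_le_exp_sum_sub_card s (a := fun i => a i / ρ)
      fun i hi => div_nonneg (ha i hi) h0.le
    rw [Finset.prod_div_distrib, Finset.prod_const, ← Finset.sum_div] at h1
    have h2 : (∑ i ∈ s, a i) / ρ - s.card < 0 := by
      rw [sub_neg, div_lt_iff₀ h0]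
      exact hc
    have h3 := h1.trans_lt ((Real.exp_lt_exp.2 h2).trans_eq Real.exp_zero)
    rw [div_lt_one (pow_pos h0 _)] at h3
    have h4 := pow_le_of_le_one h0.le hρ hcard
    linarith

/-- If the total of the losses is within `ε` of its lower bound, then so is every summand. -/
theorem excess_bound {K : ℕ} {h S P n : Fin (K + 1) → ℝ} {J η ε N x : ℝ} (hη : 0 < η)
    (hJ : 0 < J) (hN : 0 < N) (hx : 0 < x) (hxN : 2 * J * N * η ≤ x)
    (hP : ∀ k, h k ≤ x * P k) (hS : ∀ k ρ, ρ ≤ 1 → ρ ≤ P k → n k * ρ ≤ S k)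
    (hn : ∀ k, n k ≤ J)
    (hL : 1 / N * ∑ k, max 0 (x - h k) + η * ∑ k, S k ≤ η * ∑ k, n k + ε) (k : Fin (K + 1)) :
    (1 - ε / (η * J)) * x ≤ h k ∧ S k - n k ≤ ε / η := by
  have hηJ : 0 < η * J := mul_pos hη hJ
  have hxN' : 2 * (η * J) ≤ x / N := by
    rw [le_div_iff₀ hN]; linarith
  -- With `ρ = min (h k / x) 1`, the empirical term is at least `2ηJ(1 - ρ)`, while the norms save
  -- at most `ηJ(1 - ρ)`. Half of the penalty survives.
  have key : ∀ k, η * J * (1 - min (h k / x) 1) ≤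
        1 / N * max 0 (x - h k) + η * S k - η * n k ∧
      η * S k - η * n k ≤ 1 / N * max 0 (x - h k) + η * S k - η * n k := by
    intro k
    have hρ := hS k _ (min_le_right (h k / x) 1)
      ((min_le_left _ _).trans (by rw [div_le_iff₀ hx, mul_comm]; exact hP k))
    have hmax : x / N * (1 - min (h k / x) 1) = 1 / N * max 0 (x - h k) := by
      rcases le_total (h k) x with hle | hle
      · rw [min_eq_left ((div_le_one hx).2 hle), max_eq_right (by linarith)]
        field_simp
      · rw [min_eq_right ((one_le_div hx).2 hle), max_eq_left (by linarith)]
        simp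
    have h1 : 0 ≤ 1 - min (h k / x) 1 := sub_nonneg.2 (min_le_right _ _)
    have h2 := mul_le_mul_of_nonneg_right hxN' h1
    have h3 := mul_le_mul_of_nonneg_left hρ hη.le
    have h4 := mul_le_mul_of_nonneg_right (mul_le_mul_of_nonneg_left (hn k) hη.le) h1
    have h5 : 0 ≤ 1 / N * max 0 (x - h k) :=
      mul_nonneg (by positivity) (le_max_left _ _)
    exact ⟨by linarith, by linarith⟩
  have hnn : ∀ k, 0 ≤ 1 / N * max 0 (x - h k) + η * S k - η * n k := fun k =>
    (mul_nonneg hηJ.le (sub_nonneg.2 (min_le_right _ _))).trans (key k).1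
  have hk : 1 / N * max 0 (x - h k) + η * S k - η * n k ≤ ε := by
    refine (Finset.single_le_sum (f := fun k => 1 / N * max 0 (x - h k) + η * S k - η * n k)
      (fun k _ => hnn k) (Finset.mem_univ k)).trans ?_
    simp only [Finset.sum_sub_distrib, Finset.sum_add_distrib, ← Finset.mul_sum]
    linarith
  constructor
  · have h1 := (key k).1.trans hk
    have h2 : 1 - ε / (η * J) ≤ h k / x := by
      refine le_trans ?_ (min_le_left _ 1)
      have : 1 - min (h k / x) 1 ≤ ε / (η * J) := by
        rw [le_div_iff₀ hηJ]; linarith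
      linarith
    exact (le_div_iff₀ hx).1 h2
  · rw [le_div_iff₀ hη]
    linarith [(key k).2]

namespace EdgeNet

variable {I : Type} [Fintype I] (N : EdgeNet I)

theorem tail_bounds (J j : ℕ) (hj : j ≤ J) :
    N.tail J j ≤ Real.exp (∑ q ∈ Finset.Ico j J, N.normW q - (J - j)) ∧
      ∀ ρ ≤ 1, ρ ≤ N.tail J j → ((J : ℝ) - j) * ρ ≤ ∑ q ∈ Finset.Ico j J, N.normW q := by
  have h1 := prod_le_exp_sum_sub_card (Finset.Ico j J) fun q _ => N.normW_nonneg q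
  have h2 := fun ρ => card_mul_le_sum_of_le_prod (Finset.Ico j J) (ρ := ρ)
    fun q _ => N.normW_nonneg q
  rw [Nat.card_Ico, Nat.cast_sub hj] at h1
  simp only [Nat.card_Ico, Nat.cast_sub hj] at h2
  exact ⟨h1, h2⟩

theorem edge_tail_bounds (J j : ℕ) (hj : j < J) :
    N.tail J (j + 1) * N.normE j ≤
        Real.exp (∑ q ∈ Finset.Ico (j + 1) J, N.normW q + N.normE j - (J - j)) ∧
      ∀ ρ ≤ 1, ρ ≤ N.tail J (j + 1) * N.normE j →
        ((J : ℝ) - j) * ρ ≤ ∑ q ∈ Finset.Ico (j + 1) J, N.normW q + N.normE j := by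
  -- Placing the edge norm in slot `j` turns the mixed product into a product over `Ico j J`, with
  -- `J - j` factors.
  set a : ℕ → ℝ := Function.update N.normW j (N.normE j) with ha
  have hnn : ∀ q ∈ Finset.Ico j J, 0 ≤ a q := fun q _ => by
    rw [ha, Function.update_apply]
    split_ifs
    · exact N.normE_nonneg j
    · exact N.normW_nonneg q
  have heq : ∀ q ∈ Finset.Ico (j + 1) J, a q = N.normW q := fun q hq =>
    Function.update_of_ne (by have := (Finset.mem_Ico.1 hq).1; omega) _ _
  have hsum : ∑ q ∈ Finset.Ico j J, a q =
      ∑ q ∈ Finset.Ico (j + 1) J, N.normW q + N.normE j := by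
    rw [Finset.sum_eq_sum_Ico_succ_bot hj, Finset.sum_congr rfl heq, ha, Function.update_self,
      add_comm]
  have hprod : ∏ q ∈ Finset.Ico j J, a q = N.tail J (j + 1) * N.normE j := by
    rw [Finset.prod_eq_prod_Ico_succ_bot hj, Finset.prod_congr rfl heq, ha,
      Function.update_self, mul_comm, tail]
  have h1 := prod_le_exp_sum_sub_card _ hnn
  have h2 := fun ρ => card_mul_le_sum_of_le_prod (ρ := ρ) _ hnn
  rw [hsum, hprod, Nat.card_Ico, Nat.cast_sub hj.le] at h1
  simp only [hsum, hprod, Nat.card_Ico, Nat.cast_sub hj.le] at h2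
  exact ⟨h1, h2⟩

end EdgeNet

/-! ### What a nearly minimal loss implies -/

namespace MPNNParams

variable {K m d : ℕ}

/-- Only the deficit below x is kept, so a lower bound for the distances on the paths suffices. -/
theorem sum_path_le_empLoss (hd : 1 ≤ d) (hm : 1 ≤ m) {x β : ℝ≥0} (hx : x ≠ 0) (hβ : x ≤ β)
    {X : Finset BFVertex} (hX : pathTrainingSet K x β ⊆ (X : Set BFVertex))
    (θ : MPNNParams K m d) :
    1 / (X.card : ℝ) * ∑ k, max 0 ((x : ℝ) - θ.toNet.pathOut m K ⟨0, hd⟩ β x k) ≤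
      empLoss X θ := by
  classical
  refine mul_le_mul_of_nonneg_left ?_ (by positivity)
  refine le_trans ?_ (Finset.sum_le_sum_of_subset_of_nonneg
    (s := Finset.univ.image fun k : Fin (K + 1) =>
      (⟨BFInstance.path K β (Pi.single k x), Fin.last K⟩ : BFVertex))
    (fun p hp => ?_) fun p _ _ => abs_nonneg _)
  · rw [Finset.sum_image fun k _ k' _ h => path_training_injective β hx h]
    refine Finset.sum_le_sum fun k _ => max_le (abs_nonneg _) ?_
    rw [abs_sub_comm]
    refine le_trans (sub_le_sub ?_ (output_eq_feat θ hd hm _ _).le) (le_abs_self _)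
    exact_mod_cast le_dist_path hβ k K (Fin.last K) (Fin.le_last k)
  · obtain ⟨k, -, rfl⟩ := Finset.mem_image.1 hp
    exact hX ⟨k, rfl⟩

/-- The training loss controls the outputs on the paths and the products of the weight norms. -/
theorem path_bounds (hd : 1 ≤ d) (hm : 1 ≤ m) (hK : 1 ≤ K) {η ε : ℝ} (hη : 0 < η)
    {x β : ℝ≥0} {X : Finset BFVertex} (hβ : x ≤ β)
    (hX : pathTrainingSet K x β ⊆ (X : Set BFVertex))
    (hxX : 4 * (m : ℝ) * K * X.card * η ≤ x) {θ : MPNNParams K m d}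
    (hθ : loss η X θ ≤ loss η X (bellmanFord K m d) + ε) :
    0 < x ∧
    ((1 - ε / (η * (2 * m * K))) * x ≤ θ.toNet.pathOut m K ⟨0, hd⟩ β x 0 ∧
      θ.toNet.tail (2 * m * K) 0 ≤ Real.exp (ε / η)) ∧
    ∀ t (ht : t < K),
      (1 - ε / (η * (2 * m * K))) * x ≤ θ.toNet.pathOut m K ⟨0, hd⟩ β x ⟨t + 1, by omega⟩ ∧
      θ.toNet.tail (2 * m * K) (2 * m * t + 1) * θ.toNet.normE (2 * m * t) ≤
        Real.exp (ε / η) := by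
  have hm' : (0 : ℝ) < m := by exact_mod_cast hm
  have hK' : (0 : ℝ) < K := by exact_mod_cast hK
  have hN : (0 : ℝ) < X.card := by
    have : X.Nonempty := ⟨_, hX ⟨0, rfl⟩⟩
    exact_mod_cast this.card_pos
  have hx : (0 : ℝ) < x := lt_of_lt_of_le (by positivity) hxX
  have hx₀ : x ≠ 0 := fun h => by simp [h] at hx
  have hlt : ∀ t : Fin K, 2 * m * t.val < 2 * m * K := fun t =>
    Nat.mul_lt_mul_of_pos_left t.isLt (by omega)
  set N := θ.toNet
  have hE := θ.toNet_E_eq_zero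
  let S : Fin (K + 1) → ℝ := Fin.cons (∑ q ∈ Finset.Ico 0 (2 * m * K), N.normW q)
    fun t : Fin K => ∑ q ∈ Finset.Ico (2 * m * t.val + 1) (2 * m * K), N.normW q +
      N.normE (2 * m * t)
  let P : Fin (K + 1) → ℝ := Fin.cons (N.tail (2 * m * K) 0)
    fun t : Fin K => N.tail (2 * m * K) (2 * m * t.val + 1) * N.normE (2 * m * t)
  let n : Fin (K + 1) → ℝ := Fin.cons (2 * m * K) fun t : Fin K => 2 * m * K - 2 * m * t.val
  have hreg : θ.regLoss = ∑ k, S k := by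
    rw [regLoss_eq θ hd hm, Fin.sum_univ_succ, Finset.range_eq_Ico]
    simp only [S, Fin.cons_zero, Fin.cons_succ]
    rw [Fin.sum_univ_eq_sum_range (fun t => ∑ q ∈ Finset.Ico (2 * m * t + 1) (2 * m * K),
      N.normW q + N.normE (2 * m * t)) K, Finset.range_eq_Ico]
  have hn : (2 * m * K + ∑ t ∈ Finset.range K, (2 * m * K - 2 * m * t : ℝ)) = ∑ k, n k := by
    rw [Fin.sum_univ_succ]
    simp only [n, Fin.cons_zero, Fin.cons_succ]
    rw [Fin.sum_univ_eq_sum_range (fun t => (2 * m * K - 2 * m * t : ℝ)) K]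
  have hb₀ := N.tail_bounds (2 * m * K) 0 (Nat.zero_le _)
  have hb₁ := fun t : Fin K => N.edge_tail_bounds (2 * m * K) (2 * m * t) (hlt t)
  push_cast at hb₀ hb₁
  have hmain := excess_bound (h := N.pathOut m K ⟨0, hd⟩ β x) (S := S) (P := P) (n := n)
    (J := 2 * m * K) (N := X.card) (ε := ε) hη (by positivity) hN hx (by linarith)
    (fun k => by
      rcases Fin.eq_zero_or_eq_succ k with rfl | ⟨t, rfl⟩
      · exact N.pathOut_zero_le hm _ hE β x
      · refine (N.pathOut_succ_le hm _ hE β x t.isLt).trans (le_of_eq ?_)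
        simp only [P, Fin.cons_succ]
        ring)
    (fun k ρ h1 h2 => by
      rcases Fin.eq_zero_or_eq_succ k with rfl | ⟨t, rfl⟩
      · have := hb₀.2 ρ h1 h2
        rwa [sub_zero] at this
      · exact (hb₁ t).2 ρ h1 h2)
    (fun k => by
      rcases Fin.eq_zero_or_eq_succ k with rfl | ⟨t, rfl⟩
      · exact le_rfl
      · simp only [n, Fin.cons_succ]
        have : (0 : ℝ) ≤ 2 * m * (t.val : ℝ) := by positivity
        linarith)
    (by
      rw [bellmanFord_loss hd hm, hn, loss, hreg] at hθ
      have := sum_path_le_empLoss hd hm hx₀ hβ hX θ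
      linarith)
  refine ⟨hx, ⟨(hmain 0).1, hb₀.1.trans (Real.exp_le_exp.2 ?_)⟩, fun t ht =>
    ⟨(hmain (Fin.succ ⟨t, ht⟩)).1, (hb₁ ⟨t, ht⟩).1.trans (Real.exp_le_exp.2 ?_)⟩⟩
  · rw [sub_zero]; exact (hmain 0).2
  · exact (hmain (Fin.succ ⟨t, ht⟩)).2

end MPNNParams

/-! ### Assembling the estimates -/

theorem exp_le_one_add_mul {y b : ℝ} (hy : 0 ≤ y) (hb : y ≤ b) :
    Real.exp y ≤ 1 + y * Real.exp b := by
  have h1 : (1 - y) * Real.exp y ≤ 1 := by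
    have := mul_le_mul_of_nonneg_right (Real.one_sub_le_exp_neg y) (Real.exp_pos y).le
    rwa [← Real.exp_add, neg_add_cancel, Real.exp_zero] at this
  have h2 := mul_le_mul_of_nonneg_left (Real.exp_le_exp.2 hb) hy
  linarith

theorem mainTheorem6 (K m : ℕ) (hK : 1 ≤ K) (hm : 1 ≤ m) (η : ℝ) (hη : 0 < η) :
    ∃ C : ℝ, 0 < C ∧
      ∀ (d : ℕ), 1 ≤ d →
      ∀ (x β : ℝ≥0) (X : Finset BFVertex),
        2 * ((X.card : ℝ≥0) + x + 1) ≤ β →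
        pathTrainingSet K x β ⊆ (X : Set BFVertex) →
        4 * (m : ℝ) * K * X.card * η ≤ x →
      ∀ (ε : ℝ), 0 ≤ ε → ε < min (η * (2 * m * K * (K + 3))) (1 / 2) →
      ∀ θ : MPNNParams K m d,
        (∀ θ' : MPNNParams K m d,
          MPNNParams.loss η X θ ≤ MPNNParams.loss η X θ' + ε) →
      ∀ (G : BFInstance) (v : G.V),
        |θ.output G v - (G.dist K v : ℝ)| ≤ ε * C * (G.dist K v : ℝ) := by
  have hm' : (0 : ℝ) < m := by exact_mod_cast hm
  have hK' : (0 : ℝ) < K := by exact_mod_cast hK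
  -- `1 + B ε` bounds exp(ε/η) for ε < 1/2, and `D` adds the relative output deficit, so `ε * D` is
  -- the `δ` of the concentration argument.
  set B : ℝ := Real.exp (1 / (2 * η)) / η with hB
  set D : ℝ := 1 / (η * (2 * m * K)) + B with hD
  have hB₀ : 0 < B := by positivity
  have hD₀ : 0 < D := by positivity
  refine ⟨(9 + 4 * (2 * m * K)) * D, by positivity, ?_⟩
  intro d hd x β X hβ hX hxX ε hε₀ hε θ hθ G v
  have hxβ : x ≤ β := by
    refine le_trans ?_ hβ
    have h : (x : ℝ) ≤ 2 * ((X.card : ℝ) + x + 1) := by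
      have h1 : (0 : ℝ) ≤ X.card := Nat.cast_nonneg _
      have h2 := NNReal.coe_nonneg x
      linarith
    exact_mod_cast h
  have hε' : ε < 1 / 2 := hε.trans_le (min_le_right _ _)
  obtain ⟨hx, ⟨ho₀, hT₀⟩, hot⟩ := MPNNParams.path_bounds hd hm hK hη hxβ hX hxX (hθ _)
  have hx' : (0 : ℝ) < x := hx
  have hE := θ.toNet_E_eq_zero
  have hdist := NNReal.coe_nonneg (G.dist K v)
  set e₁ : ℝ := ε / (η * (2 * m * K)) with he₁
  have he₁₀ : 0 ≤ e₁ := by positivity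
  have hδ : ε * D = e₁ + B * ε := by rw [hD, he₁]; ring
  have hBε : 0 ≤ B * ε := by positivity
  have hexp : Real.exp (ε / η) ≤ 1 + B * ε := by
    refine (exp_le_one_add_mul (b := 1 / (2 * η)) (by positivity) ?_).trans (le_of_eq ?_)
    · rw [div_le_div_iff₀ hη (by positivity)]; nlinarith
    · rw [hB]; ring
  rw [MPNNParams.output_eq_feat θ hd hm]
  set N := θ.toNet
  set o : Fin d := ⟨0, hd⟩
  have hupper := N.tail_mul_feat_le hm o hE (hT₀.trans hexp)
    (fun t ht => (hot t ht).2.trans hexp) G le_rfl v o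
  rw [N.tail_self, one_mul] at hupper
  have hCD : ε * ((9 + 4 * (2 * m * K)) * D) = (9 + 4 * (2 * m * K)) * (ε * D) := by ring
  have hJ₀ : (0 : ℝ) < 2 * m * K := by positivity
  have hδ₀ : 0 ≤ ε * D := by positivity
  have hJδ : 0 ≤ (2 * m * K : ℝ) * (ε * D) := by positivity
  rw [hCD, abs_le]
  constructor
  -- Concentration needs `δ ≤ 1/8`. Otherwise the constant 9 already makes the allowed error exceed
  -- the distance, and the output is non-negative.
  · rcases le_or_gt (ε * D) (1 / 8) with hsmall | hlarge
    · have hPle : ∀ P, P ≤ Real.exp (ε / η) → (1 - ε * D) * P ≤ 1 - e₁ := fun P hP => by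
        refine (mul_le_mul_of_nonneg_left (hP.trans hexp) (by linarith)).trans ?_
        rw [hδ]
        nlinarith
      have hA₀ : 1 - e₁ ≤ N.tail (2 * m * K) 0 := by
        have := ho₀.trans (N.pathOut_zero_le hm o hE β x)
        rw [mul_comm (x : ℝ)] at this
        exact le_of_mul_le_mul_right this hx'
      have hA : ∀ t < K, 1 - e₁ ≤ N.tail (2 * m * K) (2 * m * t + 1) * N.normE (2 * m * t) := by
        intro t ht
        have := (hot t ht).1.trans (N.pathOut_succ_le hm o hE β x ht)
        refine le_of_mul_le_mul_right (this.trans (le_of_eq ?_)) hx'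
        ring
      obtain ⟨i, hi₀, hiJ, hdom⟩ := N.exists_dominant_of_pathOut hm o hE β x hδ₀ hsmall hx
        (by linarith)
        (fun t ht => pos_of_mul_pos_right (lt_of_lt_of_le (by linarith) (hA t ht))
          (N.tail_nonneg _ _))
        (le_trans (by
          have := mul_le_mul_of_nonneg_right (hPle _ hT₀) hx'.le
          linarith) ho₀)
        (fun t ht => le_trans (by
          have := mul_le_mul_of_nonneg_right (hPle _ (hot t ht).2) hx'.le
          linarith) (hot t ht).1)
      have hlow := (hdom.feat_lower hm (by linarith) (by linarith) hi₀ hA₀ hA (by linarith)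
        G le_rfl v).1
      rw [N.tail_self, one_mul, hiJ] at hlow
      -- Bernoulli with `γ = 2δ`: the J layers together lose at most `4Jδ`.
      have hpow := one_add_mul_le_pow (a := -(2 * (2 * (ε * D)))) (by linarith) (2 * m * K)
      push_cast at hpow
      rw [← sub_eq_add_neg] at hpow
      have h1 := mul_le_mul_of_nonneg_right hpow (show 0 ≤ 1 - e₁ by linarith)
      have h2 : 1 - (9 + 4 * (2 * m * K)) * (ε * D) ≤
          (1 - 2 * (2 * (ε * D))) ^ (2 * m * K) * (1 - e₁) := by
        refine le_trans ?_ h1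
        have h3 : 0 ≤ (2 * m * K : ℝ) * (ε * D) * e₁ := mul_nonneg hJδ he₁₀
        linarith
      have h4 := mul_le_mul_of_nonneg_right h2 hdist
      linarith
    · have h1 := N.feat_nonneg m o G K v o
      have h2 : 1 ≤ (9 + 4 * (2 * m * K)) * (ε * D) := by linarith
      have h3 := mul_le_mul_of_nonneg_right h2 hdist
      linarith
  · have h1 : B * ε ≤ (9 + 4 * (2 * m * K)) * (ε * D) := by linarith
    have h2 := mul_le_mul_of_nonneg_right h1 hdist
    linarith
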